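/- Let $M$ be a closed (compact, without boundary) smooth Riemannian manifold of dimension $n$, let $\mu$ be its Riemannian volume and $\operatorname{div}$ its Riemannian divergence. Let $J\subset\mathbb{R}$ be an interval of positive length containing $0$, let $u_0$ be a smooth vector field on $M$, and let $u=u(t,x)$, $t\in J$, be a smooth time-dependent vector field on $M$ whose divergence $\rho=\operatorname{div}u$ solves the Cauchy problem $$\rho_t+u\cdot\nabla\rho+\tfrac12\rho^2=-\frac{\int_M\rho^2\,d\mu}{2\mu(M)}\quad\text{on } J\times M,\qquad \rho(0,x)=\operatorname{div}u_0(x).$$ Let $\eta:J\times M\to M$ be the (smooth) flow of $u$, i.e. $\tfrac{\partial}{\partial t}\eta(t,x)=u(t,\eta(t,x))$ and $\eta(0,x)=x$. Let $\kappa$ be a real number with $$\kappa^2=\frac1{4\mu(M)}\int_M(\operatorname{div}u_0)^2\,d\mu .$$ Then for all $t\in J$ and $x\in M$ the number $\arctan\frac{\operatorname{div}u_0(x)}{2\kappa}-\kappa t$ lies in $(-\tfrac\pi2,\tfrac\pi2)$, $$\rho(t,\eta(t,x))=2\kappa\tan\Big(\arctan\frac{\operatorname{div}u_0(x)}{2\kappa}-\kappa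 t\Big),$$ and the Jacobian of the flow with respect to $\mu$ (the factor by which the differential of $\eta(t,\cdot)$ at $x$ changes Riemannian volume) is $$\mathrm{Jac}_\mu(\eta(t,x))=\Big(\cos\kappa t+\frac{\operatorname{div}u_0(x)}{2\kappa}\sin\kappa t\Big)^2 .$$ If $M$ is oriented and $\mu$ also denotes its Riemannian volume form, then $\eta(t,\cdot)^*\mu=\mathrm{Jac}_\mu(\eta(t,\cdot))\,\mu$ with the same function. When $\kappa=0$, so that $\operatorname{div}u_0\equiv0$, the quotient $\frac{\operatorname{div}u_0}{2\kappa}$ is read as $0$, and the formulas say that $\rho(t,\eta(t,x))=0$ and $\mathrm{Jac}_\mu(\eta(t,x))=1$. Moreover, if $\kappa\neq0$, then $t\mapsto\sqrt{\mathrm{Jac}_\mu(\eta(t,\cdot))}$, $t\in J$, runs along a great circle on the sphere of radius $\sqrt{\mu(M)}$ in $L^2(M,\mu)$: in $L^2(M,\mu)$, $$\sqrt{\mathrm{Jac}_\mu(\eta(t,\cdot))}=\cos(\kappa t)\,p+\sin(\kappa t)\,w,\qquad p=1,\quad w=\frac{\operatorname{div}u_0}{2\kappa},$$ where $p$ and $w$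 are orthogonal and both have norm $\sqrt{\mu(M)}$. -/

import Mathlib

open MeasureTheory Set
open scoped Manifold ContDiff

noncomputable section

namespace HunterSaxton

/-- Smooth Riemannian metrics on the `n`-dimensional manifold `M`. -/
abbrev RiemMetric (n : ℕ) (M : Type*) [TopologicalSpace M]
    [ChartedSpace (EuclideanSpace ℝ (Fin n)) M] [IsManifold (𝓡 n) ∞ M] :=
  Bundle.ContMDiffRiemannianMetric (𝓡 n) ∞ (EuclideanSpace ℝ (Fin n))
    (fun x : M => TangentSpace (𝓡 n) x)

variable {n : ℕ} {M : Type*} [TopologicalSpace M]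
  [ChartedSpace (EuclideanSpace ℝ (Fin n)) M]

/-- The coordinate vector fields `∂/∂yⁱ` of the preferred chart at `p`, at the point of `M` whose
coordinates are `y`. -/
def coordVec (p : M) (y : EuclideanSpace ℝ (Fin n)) (i : Fin n) :
    TangentSpace (𝓡 n) ((extChartAt (𝓡 n) p).symm y) :=
  mfderiv (𝓡 n) (𝓡 n) (extChartAt (𝓡 n) p).symm y (EuclideanSpace.single i (1 : ℝ))

/-- The components of the vector field `u` in the preferred chart at `p`, as functions of the
coordinates `y`. -/
def coordField (u : (x : M) → TangentSpace (𝓡 n) x) (p : M) (y : EuclideanSpace ℝ (Fin n)) :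
    EuclideanSpace ℝ (Fin n) :=
  mfderiv (𝓡 n) (𝓡 n) (extChartAt (𝓡 n) p) ((extChartAt (𝓡 n) p).symm y)
    (u ((extChartAt (𝓡 n) p).symm y))

/-- `u · ∇f = ⟨u, ∇f⟩ = df(u)`, the derivative of `f` in the direction of the field `u`. -/
def advect (u : (x : M) → TangentSpace (𝓡 n) x) (f : M → ℝ) (x : M) : ℝ :=
  mfderiv (𝓡 n) 𝓘(ℝ, ℝ) f x (u x)

variable [IsManifold (𝓡 n) ∞ M]

/-- The Riemannian volume `√ det (⟨vᵢ, vⱼ⟩)` of the parallelepiped spanned by `v₁, …, vₙ` in the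
tangent space at `x`. -/
def boxVolume (g : RiemMetric n M) (x : M) (v : Fin n → TangentSpace (𝓡 n) x) : ℝ :=
  Real.sqrt (Matrix.det (Matrix.of fun i j => g.inner x (v i) (v j)))

/-- The density `√ det (gᵢⱼ)` of the Riemannian volume in the preferred chart at `p`. -/
def chartDensity (g : RiemMetric n M) (p : M) (y : EuclideanSpace ℝ (Fin n)) : ℝ :=
  boxVolume g ((extChartAt (𝓡 n) p).symm y) (coordVec p y)

/-- The measure `√ det (gᵢⱼ) dy¹⋯dyⁿ` on the domain of the preferred chart at `p`, extended by
zero to `M`. -/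
def chartMeasure [MeasurableSpace M] (g : RiemMetric n M) (p : M) : Measure M :=
  Measure.map (extChartAt (𝓡 n) p).symm
    (((volume : Measure (EuclideanSpace ℝ (Fin n))).restrict
      (extChartAt (𝓡 n) p).target).withDensity fun y => ENNReal.ofReal (chartDensity g p y))

/-- The Riemannian volume measure. The measures `chartMeasure g p` agree on the overlaps of the
chart domains, so that their supremum is the measure on `M` glued from them. -/
def volumeMeasure [MeasurableSpace M] (g : RiemMetric n M) : Measure M :=
  ⨆ p : M, chartMeasure g p

/-- The Riemannian divergence, `div u = (1/√ det g) ∑ ∂ᵢ (√ det g · uⁱ)`, evaluated at `p` in the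
preferred chart at `p`. -/
def divergence (g : RiemMetric n M) (u : (x : M) → TangentSpace (𝓡 n) x) (p : M) : ℝ :=
  (chartDensity g p (extChartAt (𝓡 n) p p))⁻¹ *
    ∑ i : Fin n, fderiv ℝ (fun y => chartDensity g p y * coordField u p y i)
      (extChartAt (𝓡 n) p p) (EuclideanSpace.single i (1 : ℝ))

/-- The Jacobian of `f : M → M` with respect to the Riemannian volume: the factor by which the
differential of `f` at `x` changes the volume of parallelepipeds. It is computed on the standard
basis of the tangent space; any other basis gives the same value. -/
def jacobian (g : RiemMetric n M) (f : M → M) (x : M) : ℝ :=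
  boxVolume g (f x) (fun i => mfderiv (𝓡 n) (𝓡 n) f x
      (show TangentSpace (𝓡 n) x from EuclideanSpace.single i (1 : ℝ))) /
    boxVolume g x (fun i => (show TangentSpace (𝓡 n) x from EuclideanSpace.single i (1 : ℝ)))

/-- `Ω` is a Riemannian volume form of `(M, g)`, that is, the volume form of one of the
orientations of `M`: an `n`-form, continuous in charts, whose absolute value on every `n`-tuple of
tangent vectors is the volume of the parallelepiped that they span. -/
structure IsVolumeForm (g : RiemMetric n M)
    (Ω : (x : M) → (TangentSpace (𝓡 n) x) [⋀^Fin n]→ₗ[ℝ] ℝ) : Prop where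
  abs_eq : ∀ (x : M) (v : Fin n → TangentSpace (𝓡 n) x), |Ω x v| = boxVolume g x v
  continuousOn : ∀ p : M, ContinuousOn
    (fun y => Ω ((extChartAt (𝓡 n) p).symm y) (coordVec p y)) (extChartAt (𝓡 n) p).target

end HunterSaxton

end

/-! Write ρ = div u. Since div(ρ² u) = ρ³ + 2ρ u·∇ρ, the equation gives 2ρ ρ_t = 2Cρ − div(ρ² u),
where C depends on t only. Both terms on the right integrate to zero by the divergence theorem, so
∫ρ² is conserved (`integral_divergence_sq_eq`) and the right-hand side of the equation is the
constant −2κ².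

Along a trajectory, r(t) = ρ(t, η(t,x)) therefore solves the Riccati equation r' = −2κ² − r²/2. For
κ ≠ 0 this says that arctan(r/2κ) + κt is constant (`arctan_of_riccati`), which yields the tangent
formula and confines the angle to the range of arctan. For κ = 0 conservation alone forces ρ = 0.

By Liouville's formula (`IsFlow.hasDerivWithinAt_imageVolume`) the volume m spanned by the image of
a basis under the differential of the flow satisfies m' = r m. With r = 2κ tan(θ − κt) the quotient
m / cos²(θ − κt) is constant, and cos(θ − κt) / cos θ = cos κt + tan θ sin κt gives the Jacobian
(`volume_of_riccati`). This factor is positive, hence it is the square root of the Jacobian, and by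
continuity the pulled-back volume form keeps its sign. The great circle is then read off: the norm
of w comes from the choice of κ, and orthogonality to 1 from ∫ div u = 0.

The geometric input is proved in charts: coordinate invariance of the divergence
(`weightedDiv_change`), gluing of the volume measure (`volumeMeasure_apply_of_subset`), the
divergence theorem (`integral_divergence_eq_zero`) and the variational equation of the flow
(`hasDerivWithinAt_fderiv_flow`). Time derivatives are taken within J, so that endpoints of J are
covered. -/

noncomputable section

namespace HunterSaxton

/-! ### Determinants, traces and the weighted divergence in Euclidean space -/

section EuclideanCalculus

variable {n : ℕ}

local notation "𝔼" => EuclideanSpace ℝ (Fin n)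

theorem toMatrix_basisFun_apply (A : 𝔼 →ₗ[ℝ] 𝔼) (i j : Fin n) :
    LinearMap.toMatrix (EuclideanSpace.basisFun (Fin n) ℝ).toBasis
      (EuclideanSpace.basisFun (Fin n) ℝ).toBasis A i j = A (EuclideanSpace.single j 1) i := by
  simp [LinearMap.toMatrix_apply]

theorem trace_eq_sum_single (A : 𝔼 →L[ℝ] 𝔼) :
    LinearMap.trace ℝ 𝔼 A = ∑ i, A (EuclideanSpace.single i 1) i := by
  rw [LinearMap.trace_eq_matrix_trace ℝ (EuclideanSpace.basisFun (Fin n) ℝ).toBasis]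
  simp only [Matrix.trace, Matrix.diag, toMatrix_basisFun_apply, ContinuousLinearMap.coe_coe]

theorem det_eq_matrix_det (A : 𝔼 →L[ℝ] 𝔼) :
    A.det = Matrix.det (Matrix.of fun i j => A (EuclideanSpace.single j 1) i) := by
  rw [ContinuousLinearMap.det,
    ← LinearMap.det_toMatrix (EuclideanSpace.basisFun (Fin n) ℝ).toBasis]
  refine congrArg Matrix.det (Matrix.ext fun i j => ?_)
  exact toMatrix_basisFun_apply _ i j

/-- The determinant of a real matrix as a continuous multilinear function of its rows. -/
def matrixDetMultilinear (n : ℕ) : ContinuousMultilinearMap ℝ (fun _ : Fin n => Fin n → ℝ) ℝ where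
  toMultilinearMap := (Matrix.detRowAlternating (n := Fin n) (R := ℝ)).toMultilinearMap
  cont := Continuous.matrix_det (A := fun M : Fin n → Fin n → ℝ => Matrix.of M) continuous_id

/-- Jacobi's formula for a curve of linear maps that satisfies `A' = B A`. -/
theorem hasDerivWithinAt_det {A : ℝ → 𝔼 →L[ℝ] 𝔼} {B : 𝔼 →L[ℝ] 𝔼} {s : Set ℝ} {t : ℝ}
    (h : HasDerivWithinAt A (B ∘L A t) s t) :
    HasDerivWithinAt (fun τ => (A τ).det) (LinearMap.trace ℝ 𝔼 B * (A t).det) s t := by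
  set m : ℝ → Fin n → Fin n → ℝ := fun τ i j => A τ (EuclideanSpace.single j 1) i with hm
  have hm' : HasDerivWithinAt m (fun i j => B (A t (EuclideanSpace.single j 1)) i) s t := by
    refine hasDerivWithinAt_pi.2 fun i => hasDerivWithinAt_pi.2 fun j => ?_
    exact ((EuclideanSpace.proj i : 𝔼 →L[ℝ] ℝ).hasFDerivAt.comp_hasDerivWithinAt t
      (((ContinuousLinearMap.apply ℝ 𝔼 (EuclideanSpace.single j (1 : ℝ))).hasFDerivAt).comp_hasDerivWithinAt t h))
  have hd := ((matrixDetMultilinear n).hasFDerivAt (m t)).comp_hasDerivWithinAt t hm'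
  have h1 : (fun τ => (A τ).det) = matrixDetMultilinear n ∘ m := by
    funext τ
    exact det_eq_matrix_det _
  rw [h1]
  refine hd.congr_deriv ?_
  symm
  rw [ContinuousMultilinearMap.linearDeriv_apply, trace_eq_sum_single, Finset.sum_mul]
  refine Finset.sum_congr rfl fun i _ => ?_
  -- Row i of B A is the combination of the rows of A with coefficients B i k. Substituted for row i
  -- of A, only the term k = i survives in the determinant and contributes B i i * det A.
  have h2 : (fun j => B (A t (EuclideanSpace.single j 1)) i)
      = ∑ k, B (EuclideanSpace.single k 1) i • m t k := by
    funext j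
    have : A t (EuclideanSpace.single j 1)
        = ∑ k, A t (EuclideanSpace.single j 1) k • EuclideanSpace.single k (1 : ℝ) := by
      conv_lhs => rw [← (EuclideanSpace.basisFun (Fin n) ℝ).sum_repr (A t (EuclideanSpace.single j 1))]
      simp
    conv_lhs => rw [this]
    simp [hm, mul_comm]
  have h3 := Matrix.det_updateRow_sum (Matrix.of (m t)) i fun k => B (EuclideanSpace.single k 1) i
  rw [smul_eq_mul] at h3
  have h4 : (A t).det = (Matrix.of (m t)).det := det_eq_matrix_det _
  rw [h4, ← h3]
  change _ = Matrix.det (Function.update (m t) i _)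
  rw [h2]
  rfl

/-- At a zero of f the assumed derivative vanishes, so f, and with it |f|, is o(τ - t). Volumes can
thus be differentiated before the determinant is known to be nonzero. -/
theorem hasDerivWithinAt_abs_of_mul {f : ℝ → ℝ} {b : ℝ} {s : Set ℝ} {t : ℝ}
    (h : HasDerivWithinAt f (b * f t) s t) :
    HasDerivWithinAt (fun τ => |f τ|) (b * |f t|) s t := by
  by_cases h0 : f t = 0
  · rw [h0, mul_zero, hasDerivWithinAt_iff_isLittleO] at h
    rw [h0, abs_zero, mul_zero, hasDerivWithinAt_iff_isLittleO]
    simpa [h0] using h.norm_left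
  · have := (hasDerivAt_abs h0).comp_hasDerivWithinAt t h
    refine this.congr_deriv ?_
    rw [mul_left_comm]
    congr 1
    rcases lt_or_gt_of_ne h0 with h | h
    · rw [abs_of_neg h, sign_neg h]; simp
    · rw [abs_of_pos h, sign_pos h]; simp

theorem hasDerivWithinAt_abs_det {A : ℝ → 𝔼 →L[ℝ] 𝔼} {B : 𝔼 →L[ℝ] 𝔼} {s : Set ℝ} {t : ℝ}
    (h : HasDerivWithinAt A (B ∘L A t) s t) :
    HasDerivWithinAt (fun τ => |(A τ).det|) (LinearMap.trace ℝ 𝔼 B * |(A t).det|) s t :=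
  hasDerivWithinAt_abs_of_mul (hasDerivWithinAt_det h)

/-- The divergence, in coordinates, of the vector field `X` with respect to the density `w`. -/
def weightedDiv (w : 𝔼 → ℝ) (X : 𝔼 → 𝔼) (y : 𝔼) : ℝ :=
  (w y)⁻¹ * ∑ i : Fin n, fderiv ℝ (fun z => w z * X z i) y (EuclideanSpace.single i (1 : ℝ))

theorem weightedDiv_congr {w₁ w₂ : 𝔼 → ℝ} {X₁ X₂ : 𝔼 → 𝔼} {y : 𝔼}
    (hw : w₁ =ᶠ[nhds y] w₂) (hX : X₁ =ᶠ[nhds y] X₂) :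
    weightedDiv w₁ X₁ y = weightedDiv w₂ X₂ y := by
  unfold weightedDiv
  rw [hw.eq_of_nhds]
  congr 1
  refine Finset.sum_congr rfl fun i _ => ?_
  have : (fun z => w₁ z * X₁ z i) =ᶠ[nhds y] fun z => w₂ z * X₂ z i := by
    filter_upwards [hw, hX] with z h1 h2
    rw [h1, h2]
  rw [this.fderiv_eq]

theorem sum_single_smul (x : 𝔼) : ∑ i, x i • EuclideanSpace.single i (1 : ℝ) = x := by
  conv_rhs => rw [← (EuclideanSpace.basisFun (Fin n) ℝ).sum_repr x]
  simp

/-- The product rule splits off the logarithmic derivative of the density along X. This form matches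
the two factors, determinant and density, in the change of variables and in Liouville's formula. -/
theorem weightedDiv_eq {w : 𝔼 → ℝ} {X : 𝔼 → 𝔼} {y : 𝔼} (hw : DifferentiableAt ℝ w y)
    (hX : DifferentiableAt ℝ X y) (h0 : w y ≠ 0) :
    weightedDiv w X y = LinearMap.trace ℝ 𝔼 (fderiv ℝ X y) + (w y)⁻¹ * fderiv ℝ w y (X y) := by
  have hXi : ∀ i, HasFDerivAt (fun z => X z i)
      ((EuclideanSpace.proj i : 𝔼 →L[ℝ] ℝ) ∘L fderiv ℝ X y) y := fun i =>
    (EuclideanSpace.proj i : 𝔼 →L[ℝ] ℝ).hasFDerivAt.comp y hX.hasFDerivAt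
  have h1 : ∀ i : Fin n, fderiv ℝ (fun z => w z * X z i) y (EuclideanSpace.single i (1 : ℝ))
      = w y * fderiv ℝ X y (EuclideanSpace.single i 1) i
        + X y i * fderiv ℝ w y (EuclideanSpace.single i 1) := fun i => by
    rw [HasFDerivAt.fderiv (f := fun z => w z * X z i) (hw.hasFDerivAt.mul (hXi i))]
    simp
  have h2 : ∑ i, X y i * fderiv ℝ w y (EuclideanSpace.single i 1) = fderiv ℝ w y (X y) := by
    conv_rhs => rw [← sum_single_smul (X y)]
    simp
  unfold weightedDiv
  rw [Finset.sum_congr rfl fun i _ => h1 i, Finset.sum_add_distrib, ← Finset.mul_sum, h2,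
    ← trace_eq_sum_single]
  field_simp

/-- The coordinate expression of the divergence does not depend on the coordinates. -/
theorem weightedDiv_change {ψ : 𝔼 → 𝔼} {w v : 𝔼 → ℝ} {X Y : 𝔼 → 𝔼} {y : 𝔼}
    (hψ : ContDiffAt ℝ 2 ψ y) (hdet : (fderiv ℝ ψ y).det ≠ 0)
    (hXY : ∀ᶠ z in nhds y, Y (ψ z) = fderiv ℝ ψ z (X z))
    (hwv : ∀ᶠ z in nhds y, w z = |(fderiv ℝ ψ z).det| * v (ψ z))
    (hw : DifferentiableAt ℝ w y) (hv : DifferentiableAt ℝ v (ψ y)) (hv0 : v (ψ y) ≠ 0)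
    (hX : DifferentiableAt ℝ X y) (hY : DifferentiableAt ℝ Y (ψ y)) :
    weightedDiv w X y = weightedDiv v Y (ψ y) := by
  have hψ' : DifferentiableAt ℝ ψ y := hψ.differentiableAt (by norm_num)
  have hDψ : DifferentiableAt ℝ (fderiv ℝ ψ) y :=
    (hψ.fderiv_right (m := 1) (by norm_num)).differentiableAt (by norm_num)
  have hsymm : IsSymmSndFDerivAt ℝ ψ y := hψ.isSymmSndFDerivAt (by simp)
  set A := fderiv ℝ ψ y with hA
  set N : 𝔼 →L[ℝ] 𝔼 := fderiv ℝ (fderiv ℝ ψ) y (X y) with hN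
  let Ae : 𝔼 ≃L[ℝ] 𝔼 := A.toContinuousLinearEquivOfDetNeZero hdet
  let Ai : 𝔼 →L[ℝ] 𝔼 := Ae.symm
  have hAi1 : ∀ x, Ai (A x) = x := fun x => Ae.symm_apply_apply x
  have hAi2 : ∀ x, A (Ai x) = x := fun x => Ae.apply_symm_apply x
  -- the derivative of the relation between the two fields
  have hDXY : (fderiv ℝ Y (ψ y)) ∘L A = N + A ∘L fderiv ℝ X y := by
    have h1 : HasFDerivAt (fun z => Y (ψ z)) ((fderiv ℝ Y (ψ y)) ∘L A) y :=
      hY.hasFDerivAt.comp y hψ'.hasFDerivAt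
    have h2 := hDψ.hasFDerivAt.clm_apply hX.hasFDerivAt
    have h3 := (h1.congr_of_eventuallyEq (hXY.mono fun z hz => hz.symm)).unique h2
    rw [h3]
    ext1 x
    simp only [add_apply, ContinuousLinearMap.comp_apply,
      ContinuousLinearMap.flip_apply]
    rw [add_comm, hsymm.eq x (X y)]
  -- With N = D²ψ(X, ·) and A = Dψ, one has DY = N A⁻¹ + A DX A⁻¹. The defect tr(N A⁻¹) is the
  -- logarithmic derivative of |det Dψ| along X, which the densities contribute with the opposite
  -- sign.
  have htr : LinearMap.trace ℝ 𝔼 (fderiv ℝ Y (ψ y))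
      = LinearMap.trace ℝ 𝔼 ((N ∘L Ai : 𝔼 →L[ℝ] 𝔼)) + LinearMap.trace ℝ 𝔼 (fderiv ℝ X y) := by
    have h1 : fderiv ℝ Y (ψ y) = N ∘L Ai + A ∘L ((fderiv ℝ X y) ∘L Ai) := by
      ext1 x
      have := congrArg (fun L : 𝔼 →L[ℝ] 𝔼 => L (Ai x)) hDXY
      simpa [hAi2] using this
    rw [h1]
    have h2 : LinearMap.trace ℝ 𝔼 ((A ∘L ((fderiv ℝ X y) ∘L Ai) : 𝔼 →L[ℝ] 𝔼))
        = LinearMap.trace ℝ 𝔼 (fderiv ℝ X y) := by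
      have h3 := LinearMap.trace_mul_comm ℝ (A : 𝔼 →ₗ[ℝ] 𝔼)
        (((fderiv ℝ X y) ∘L Ai : 𝔼 →L[ℝ] 𝔼) : 𝔼 →ₗ[ℝ] 𝔼)
      refine h3.trans ?_
      congr 1
      ext1 x
      change fderiv ℝ X y (Ai (A x)) = _
      rw [hAi1]; rfl
    rw [ContinuousLinearMap.toLinearMap_add, map_add, h2]
  -- the derivative of the density in the direction of the field
  have hline : HasDerivAt (fun s : ℝ => y + s • X y) (X y) 0 := by
    simpa using ((hasDerivAt_id (0 : ℝ)).smul_const (X y)).const_add y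
  have hline0 : (fun s : ℝ => y + s • X y) 0 = y := by simp
  have hcurve : HasDerivAt (fun s : ℝ => fderiv ℝ ψ (y + s • X y)) N 0 := by
    have := HasFDerivAt.comp_hasDerivAt_of_eq (x := (0 : ℝ)) (f := fun s : ℝ => y + s • X y)
      (l := fderiv ℝ ψ) (l' := fderiv ℝ (fderiv ℝ ψ) y) (y := y) hDψ.hasFDerivAt hline hline0.symm
    exact this
  have hdetd : HasDerivAt (fun s : ℝ => |(fderiv ℝ ψ (y + s • X y)).det|)
      (LinearMap.trace ℝ 𝔼 ((N ∘L Ai : 𝔼 →L[ℝ] 𝔼)) * |A.det|) 0 := by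
    have h1 : HasDerivWithinAt (fun s : ℝ => fderiv ℝ ψ (y + s • X y))
        ((N ∘L Ai) ∘L fderiv ℝ ψ (y + (0 : ℝ) • X y)) univ 0 := by
      rw [hasDerivWithinAt_univ]
      refine hcurve.congr_deriv ?_
      ext1 x
      simp [← hA, hAi1]
    simpa [← hA] using hasDerivWithinAt_abs_det h1
  have hvd : HasDerivAt (fun s : ℝ => v (ψ (y + s • X y))) (fderiv ℝ v (ψ y) (A (X y))) 0 := by
    have h1 : HasFDerivAt (fun z => v (ψ z)) ((fderiv ℝ v (ψ y)) ∘L A) y :=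
      hv.hasFDerivAt.comp y hψ'.hasFDerivAt
    exact HasFDerivAt.comp_hasDerivAt_of_eq (x := (0 : ℝ)) (f := fun s : ℝ => y + s • X y) (y := y)
      h1 hline hline0.symm
  have hwd : HasDerivAt (fun s : ℝ => w (y + s • X y)) (fderiv ℝ w y (X y)) 0 :=
    HasFDerivAt.comp_hasDerivAt_of_eq (x := (0 : ℝ)) (f := fun s : ℝ => y + s • X y) (y := y)
      hw.hasFDerivAt hline hline0.symm
  have hev : (fun s : ℝ => w (y + s • X y)) =ᶠ[nhds 0]
      fun s : ℝ => |(fderiv ℝ ψ (y + s • X y)).det| * v (ψ (y + s • X y)) := by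
    have : Filter.Tendsto (fun s : ℝ => y + s • X y) (nhds 0) (nhds y) := by
      have := hline.continuousAt.tendsto
      rwa [zero_smul, add_zero] at this
    exact this.eventually hwv
  have hwX : fderiv ℝ w y (X y) = LinearMap.trace ℝ 𝔼 ((N ∘L Ai : 𝔼 →L[ℝ] 𝔼)) * |A.det| * v (ψ y)
      + |A.det| * fderiv ℝ v (ψ y) (A (X y)) := by
    have := (hwd.congr_of_eventuallyEq hev.symm).unique (hdetd.mul hvd)
    simpa [← hA] using this
  have hwy : w y = |A.det| * v (ψ y) := hwv.self_of_nhds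
  have hdet' : |A.det| ≠ 0 := abs_ne_zero.2 hdet
  have hw0 : w y ≠ 0 := hwy ▸ mul_ne_zero hdet' hv0
  rw [weightedDiv_eq hw hX hw0, weightedDiv_eq hv hY hv0, hwX, htr, hXY.self_of_nhds, hwy, ← hA]
  field_simp
  ring

end EuclideanCalculus

/-! ### Gram determinants and top-degree forms under linear maps -/

section Gram

variable {n : ℕ}

local notation "𝔼" => EuclideanSpace ℝ (Fin n)

/-- The Gram determinant of the images of the standard basis under `A`. -/
theorem sqrt_det_gram_comp (G : 𝔼 →L[ℝ] 𝔼 →L[ℝ] ℝ) (A : 𝔼 →L[ℝ] 𝔼) :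
    Real.sqrt (Matrix.det (Matrix.of fun i j : Fin n =>
        G (A (EuclideanSpace.single i 1)) (A (EuclideanSpace.single j 1))))
      = |A.det| * Real.sqrt (Matrix.det (Matrix.of fun i j : Fin n =>
          G (EuclideanSpace.single i 1) (EuclideanSpace.single j 1))) := by
  set a : Matrix (Fin n) (Fin n) ℝ := Matrix.of fun i j => A (EuclideanSpace.single j 1) i with ha
  set G₀ : Matrix (Fin n) (Fin n) ℝ := Matrix.of fun i j : Fin n =>
          G (EuclideanSpace.single i 1) (EuclideanSpace.single j 1) with hG₀
  have h : (Matrix.of fun i j : Fin n =>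
        G (A (EuclideanSpace.single i 1)) (A (EuclideanSpace.single j 1))) = a.transpose * G₀ * a := by
    ext i j
    rw [Matrix.of_apply]
    conv_lhs => rw [← sum_single_smul (A (EuclideanSpace.single i 1)),
      ← sum_single_smul (A (EuclideanSpace.single j 1))]
    simp only [map_sum, map_smul, Matrix.mul_apply, Matrix.transpose_apply, ha, hG₀,
      Matrix.of_apply, sum_apply, smul_apply, smul_eq_mul,
      Finset.mul_sum, Finset.sum_mul]
    refine Finset.sum_congr rfl fun k _ => Finset.sum_congr rfl fun l _ => ?_
    ring
  rw [h, Matrix.det_mul, Matrix.det_mul, Matrix.det_transpose, det_eq_matrix_det A, ← ha,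
    show a.det * G₀.det * a.det = a.det ^ 2 * G₀.det by ring, Real.sqrt_mul (sq_nonneg _),
    Real.sqrt_sq_eq_abs]

theorem det_gram_pos (G : 𝔼 →L[ℝ] 𝔼 →L[ℝ] ℝ) (hs : ∀ v w, G v w = G w v)
    (hp : ∀ v, v ≠ 0 → 0 < G v v) :
    0 < Matrix.det (Matrix.of fun i j : Fin n =>
      G (EuclideanSpace.single i 1) (EuclideanSpace.single j 1)) := by
  refine Matrix.PosDef.det_pos (Matrix.PosDef.of_dotProduct_mulVec_pos ?_ fun x hx => ?_)
  · ext i j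
    simp [Matrix.conjTranspose_apply, hs (EuclideanSpace.single j 1)]
  · have h0 : (WithLp.toLp 2 x : 𝔼) ≠ 0 := by
      intro h
      exact hx (by simpa using congrArg WithLp.ofLp h)
    have := hp _ h0
    rw [← sum_single_smul (WithLp.toLp 2 x : 𝔼)] at this
    simp only [map_sum, map_smul, sum_apply, smul_apply,
      smul_eq_mul] at this
    refine this.trans_eq (Finset.sum_congr rfl fun i _ => ?_)
    refine congrArg (x i * ·) (Finset.sum_congr rfl fun j _ => ?_)
    rw [hs, mul_comm]
    rfl

/-- Top-degree forms are multiples of the determinant; this is the signed counterpart of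
`sqrt_det_gram_comp`. -/
theorem alternating_comp_single (Ω : 𝔼 [⋀^Fin n]→ₗ[ℝ] ℝ) (A : 𝔼 →L[ℝ] 𝔼) :
    Ω (fun i => A (EuclideanSpace.single i 1))
      = A.det * Ω (fun i => EuclideanSpace.single i 1) := by
  set b := (EuclideanSpace.basisFun (Fin n) ℝ).toBasis with hb
  have hbe : (fun i => EuclideanSpace.single i (1 : ℝ)) = (b : Fin n → 𝔼) := by
    funext i; simp [hb]
  have h1 := Ω.eq_smul_basis_det b
  have h2 : Ω (fun i => A (EuclideanSpace.single i 1)) = Ω b * b.det (fun i => A (b i)) := by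
    conv_lhs => rw [h1]
    simp [hb]
  rw [h2, hbe]
  have h3 := b.det_comp (A : 𝔼 →ₗ[ℝ] 𝔼) b
  rw [b.det_self, mul_one] at h3
  rw [mul_comm]
  congr 1

end Gram

/-! ### Fields, densities and divergence in the charts of the manifold -/

section Charts

variable {n : ℕ} {M : Type*} [TopologicalSpace M]
  [ChartedSpace (EuclideanSpace ℝ (Fin n)) M]

local notation "𝔼" => EuclideanSpace ℝ (Fin n)
local notation "φ" => extChartAt (M := M) (𝓡 n)

theorem isOpen_chart_target (p : M) : IsOpen (φ p).target := isOpen_extChartAt_target p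

theorem isOpen_chart_source (p : M) : IsOpen (φ p).source := isOpen_extChartAt_source p

/-- The transition map from the preferred chart at `p` to the one at `q`. -/
def transition (p q : M) (y : 𝔼) : 𝔼 := φ q ((φ p).symm y)

/-- The domain of the transition map. -/
def overlap (p q : M) : Set 𝔼 := (φ p).target ∩ (φ p).symm ⁻¹' (φ q).source

theorem isOpen_overlap (p q : M) : IsOpen (overlap (n := n) p q) :=
  (continuousOn_extChartAt_symm p).isOpen_inter_preimage (isOpen_chart_target p)
    (isOpen_chart_source q)

/-- The vector field `u` has smooth components in every preferred chart. -/
def IsSmoothField (u : (x : M) → TangentSpace (𝓡 n) x) : Prop :=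
  ∀ p : M, ContDiffOn ℝ ∞ (coordField u p) (φ p).target

theorem IsSmoothField.differentiableAt {u : (x : M) → TangentSpace (𝓡 n) x} (hu : IsSmoothField u)
    {p : M} {y : 𝔼} (hy : y ∈ (φ p).target) : DifferentiableAt ℝ (coordField u p) y :=
  ((hu p).contDiffAt ((isOpen_chart_target p).mem_nhds hy)).differentiableAt (by simp)

variable [IsManifold (𝓡 n) ∞ M]

/-- The differential at `x` of the preferred chart at `p`. -/
def chartDeriv (p x : M) : TangentSpace (𝓡 n) x →L[ℝ] 𝔼 :=
  (trivializationAt 𝔼 (TangentSpace (𝓡 n)) p).continuousLinearMapAt ℝ x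

/-- The inverse of the differential at `x` of the preferred chart at `p`. -/
def chartFrame (p x : M) : 𝔼 →L[ℝ] TangentSpace (𝓡 n) x :=
  (trivializationAt 𝔼 (TangentSpace (𝓡 n)) p).symmL ℝ x

theorem mem_baseSet {p x : M} (hx : x ∈ (φ p).source) :
    x ∈ (trivializationAt 𝔼 (TangentSpace (𝓡 n)) p).baseSet := by
  simpa using hx

theorem chartDeriv_chartFrame {p x : M} (hx : x ∈ (φ p).source) (v : 𝔼) :
    chartDeriv p x (chartFrame p x v) = v :=
  (trivializationAt 𝔼 (TangentSpace (𝓡 n)) p).continuousLinearMapAt_symmL (mem_baseSet hx) v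

theorem chartFrame_chartDeriv {p x : M} (hx : x ∈ (φ p).source) (v : TangentSpace (𝓡 n) x) :
    chartFrame p x (chartDeriv p x v) = v :=
  (trivializationAt 𝔼 (TangentSpace (𝓡 n)) p).symmL_continuousLinearMapAt (mem_baseSet hx) v

theorem mfderiv_chart {p x : M} (hx : x ∈ (φ p).source) :
    mfderiv (𝓡 n) (𝓡 n) (φ p) x = chartDeriv p x :=
  (TangentBundle.continuousLinearMapAt_trivializationAt (by simpa using hx)).symm

theorem mfderiv_chart_symm {p : M} {y : 𝔼} (hy : y ∈ (φ p).target) :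
    mfderiv (𝓡 n) (𝓡 n) (φ p).symm y = chartFrame p ((φ p).symm y) := by
  have h := TangentBundle.symmL_trivializationAt (I := 𝓡 n) (x₀ := p) (x := (φ p).symm y)
    (by simpa using (φ p).map_target hy)
  rw [ModelWithCorners.range_eq_univ, mfderivWithin_univ] at h
  -- The base point φ(φ⁻¹ y) equals y only propositionally, and the type of `mfderiv` depends on it.
  -- Viewing all tangent spaces as 𝔼 permits the substitution.
  have key : ∀ y' : 𝔼, y' = y → (mfderiv (𝓡 n) (𝓡 n) (φ p).symm y' : 𝔼 →L[ℝ] 𝔼)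
      = (mfderiv (𝓡 n) (𝓡 n) (φ p).symm y : 𝔼 →L[ℝ] 𝔼) := by
    rintro _ rfl; rfl
  exact (h.trans (key _ ((φ p).right_inv hy))).symm

theorem fderiv_comp_chart_symm {F : Type*} [NormedAddCommGroup F] [NormedSpace ℝ F] {f : M → F}
    {q x : M} (hx : x ∈ (φ q).source) (hf : MDifferentiableAt (𝓡 n) 𝓘(ℝ, F) f x) (v : 𝔼) :
    fderiv ℝ (fun y => f ((φ q).symm y)) (φ q x) v
      = mfderiv (𝓡 n) 𝓘(ℝ, F) f x (chartFrame q x v) := by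
  have hy : φ q x ∈ (φ q).target := (φ q).map_source hx
  have h2 : MDifferentiableAt (𝓡 n) (𝓡 n) (φ q).symm (φ q x) := by
    have := mdifferentiableWithinAt_extChartAt_symm (I := 𝓡 n) hy
    rwa [ModelWithCorners.range_eq_univ, mdifferentiableWithinAt_univ] at this
  have h := mfderiv_comp_of_eq (x := φ q x) hf h2 ((φ q).left_inv hx)
  rw [mfderiv_chart_symm hy, mfderiv_eq_fderiv] at h
  have h3 : ∀ v : 𝔼, fderiv ℝ (fun y => f ((φ q).symm y)) (φ q x) v
      = mfderiv (𝓡 n) 𝓘(ℝ, F) f ((φ q).symm (φ q x)) (chartFrame q ((φ q).symm (φ q x)) v) :=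
    fun v => congrArg (fun L : 𝔼 →L[ℝ] F => L v) h
  rw [h3, (φ q).left_inv hx]

theorem coordVec_eq {p : M} {y : 𝔼} (hy : y ∈ (φ p).target) :
    coordVec p y = fun i => chartFrame p ((φ p).symm y) (EuclideanSpace.single i 1) := by
  funext i
  unfold coordVec
  rw [mfderiv_chart_symm hy]
  rfl

theorem coordField_eq (u : (x : M) → TangentSpace (𝓡 n) x) {p : M} {y : 𝔼}
    (hy : y ∈ (φ p).target) :
    coordField u p y = chartDeriv p ((φ p).symm y) (u ((φ p).symm y)) := by
  unfold coordField
  rw [mfderiv_chart ((φ p).map_target hy)]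
  rfl

theorem coordField_chart (u : (x : M) → TangentSpace (𝓡 n) x) {p x : M}
    (hx : x ∈ (φ p).source) : coordField u p (φ p x) = chartDeriv p x (u x) := by
  rw [coordField_eq u ((φ p).map_source hx), (φ p).left_inv hx]

theorem chartDensity_chart (g : RiemMetric n M) {p x : M} (hx : x ∈ (φ p).source) :
    chartDensity g p (φ p x)
      = boxVolume g x fun i => chartFrame p x (EuclideanSpace.single i 1) := by
  unfold chartDensity
  rw [coordVec_eq ((φ p).map_source hx), (φ p).left_inv hx]

/-- Factors a Riemannian volume into a determinant, to which Jacobi's formula applies, and a smooth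
density. It yields both the transformation law of densities and the volume carried by the flow. -/
theorem boxVolume_comp (g : RiemMetric n M) {q x : M} (hx : x ∈ (φ q).source)
    (L : 𝔼 →L[ℝ] TangentSpace (𝓡 n) x) :
    boxVolume g x (fun i => L (EuclideanSpace.single i 1))
      = |(chartDeriv q x ∘L L : 𝔼 →L[ℝ] 𝔼).det| * chartDensity g q (φ q x) := by
  rw [chartDensity_chart g hx]
  let F : 𝔼 →L[ℝ] 𝔼 := chartFrame q x
  let G₀ : 𝔼 →L[ℝ] 𝔼 →L[ℝ] ℝ := g.inner x
  let G : 𝔼 →L[ℝ] 𝔼 →L[ℝ] ℝ := G₀.bilinearComp F F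
  have h := sqrt_det_gram_comp G (chartDeriv q x ∘L L)
  have hG : ∀ v w : 𝔼, G v w = g.inner x (chartFrame q x v) (chartFrame q x w) := fun _ _ => rfl
  simp only [hG, ContinuousLinearMap.comp_apply, chartFrame_chartDeriv hx] at h
  exact h

theorem boxVolume_frame_pos (g : RiemMetric n M) {q x : M} (hx : x ∈ (φ q).source) :
    0 < Matrix.det (Matrix.of fun i j : Fin n => g.inner x
      (chartFrame q x (EuclideanSpace.single i 1)) (chartFrame q x (EuclideanSpace.single j 1))) := by
  let F : 𝔼 →L[ℝ] 𝔼 := chartFrame q x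
  let G₀ : 𝔼 →L[ℝ] 𝔼 →L[ℝ] ℝ := g.inner x
  let G : 𝔼 →L[ℝ] 𝔼 →L[ℝ] ℝ := G₀.bilinearComp F F
  refine det_gram_pos G (fun v w => g.symm x _ _) fun v hv => g.pos x _ fun h => hv ?_
  rw [← chartDeriv_chartFrame hx v]
  exact (congrArg (chartDeriv q x) h).trans (map_zero _)

theorem chartDensity_pos (g : RiemMetric n M) {p : M} {y : 𝔼} (hy : y ∈ (φ p).target) :
    0 < chartDensity g p y := by
  unfold chartDensity
  rw [coordVec_eq hy]
  exact Real.sqrt_pos.2 (boxVolume_frame_pos g ((φ p).map_target hy))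

/-- The base point is left as φ⁻¹(φ x) to match the form of the continuity condition in
`IsVolumeForm`. -/
theorem alternating_comp (Ω : (x : M) → (TangentSpace (𝓡 n) x) [⋀^Fin n]→ₗ[ℝ] ℝ) {q x : M}
    (hx : x ∈ (φ q).source) (L : 𝔼 →L[ℝ] TangentSpace (𝓡 n) x) :
    Ω x (fun i => L (EuclideanSpace.single i 1))
      = (chartDeriv q x ∘L L : 𝔼 →L[ℝ] 𝔼).det
        * Ω ((φ q).symm (φ q x)) (coordVec q (φ q x)) := by
  rw [coordVec_eq ((φ q).map_source hx), (φ q).left_inv hx]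
  have h := alternating_comp_single ((Ω x).compLinearMap (chartFrame q x).toLinearMap)
    (chartDeriv q x ∘L L)
  simp only [AlternatingMap.compLinearMap_apply, ContinuousLinearMap.comp_apply,
    ContinuousLinearMap.coe_coe, chartFrame_chartDeriv hx] at h
  exact h

/-- The chart density is smooth. -/
theorem contDiffOn_chartDensity (g : RiemMetric n M) (p : M) :
    ContDiffOn ℝ ∞ (chartDensity g p) (φ p).target := by
  have hframe : ∀ i : Fin n, ContMDiffOn (𝓡 n) (𝓡 n).tangent ∞
      (fun x : M => (⟨x, chartFrame p x (EuclideanSpace.single i 1)⟩ : TangentBundle (𝓡 n) M))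
      (φ p).source := by
    intro i
    have hb : (φ p).source = (trivializationAt 𝔼 (TangentSpace (𝓡 n)) p).baseSet := by simp
    rw [hb]
    refine ((trivializationAt 𝔼 (TangentSpace (𝓡 n)) p).contMDiffOn_section_baseSet_iff).2 ?_
    refine (contMDiffOn_const (c := EuclideanSpace.single i (1 : ℝ))).congr fun x hx => ?_
    have h := chartDeriv_chartFrame (p := p) (x := x) (by rwa [hb]) (EuclideanSpace.single i (1 : ℝ))
    refine Eq.trans ?_ h
    unfold chartDeriv
    rw [Bundle.Trivialization.continuousLinearMapAt_apply, Bundle.Trivialization.coe_linearMapAt_of_mem _ hx]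
  have hentry : ∀ i j : Fin n, ContDiffOn ℝ ∞ (fun y => g.inner ((φ p).symm y)
      (chartFrame p ((φ p).symm y) (EuclideanSpace.single i 1))
      (chartFrame p ((φ p).symm y) (EuclideanSpace.single j 1))) (φ p).target := by
    intro i j
    have h1 : ContMDiffOn (𝓡 n) 𝓘(ℝ, ℝ) ∞ (fun x : M => g.inner x
        (chartFrame p x (EuclideanSpace.single i 1)) (chartFrame p x (EuclideanSpace.single j 1)))
        (φ p).source := by
      have h2 := ContMDiffOn.clm_bundle_apply₂ (F₁ := 𝔼) (F₂ := 𝔼) (F₃ := ℝ)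
        (E₃ := Bundle.Trivial M ℝ) g.contMDiff.contMDiffOn (hframe i) (hframe j)
      intro x hx
      have h3 := h2 x hx
      simp only [Bundle.contMDiffWithinAt_totalSpace] at h3
      exact h3.2
    rw [← contMDiffOn_iff_contDiffOn]
    exact h1.comp (contMDiffOn_extChartAt_symm p) fun y hy => (φ p).map_target hy
  have hdet : ContDiffOn ℝ ∞ (fun y => Matrix.det (Matrix.of fun i j : Fin n =>
      g.inner ((φ p).symm y)
      (chartFrame p ((φ p).symm y) (EuclideanSpace.single i 1))
      (chartFrame p ((φ p).symm y) (EuclideanSpace.single j 1)))) (φ p).target := by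
    simp only [Matrix.det_apply]
    refine ContDiffOn.sum fun σ _ => ContDiffOn.const_smul _ ?_
    exact contDiffOn_prod fun i _ => hentry _ _
  -- The square root is smooth here because the Gram determinant of the chart frame is never zero.
  refine (hdet.sqrt fun y hy => (boxVolume_frame_pos g ((φ p).map_target hy)).ne').congr ?_
  intro y hy
  unfold chartDensity
  rw [coordVec_eq hy]
  rfl

/-- The components of a smooth time-dependent field are smooth functions of time and the
coordinates. -/
theorem contDiffOn_coordField {J : Set ℝ} {u : ℝ → (x : M) → TangentSpace (𝓡 n) x}
    (hu : ContMDiffOn (𝓘(ℝ, ℝ).prod (𝓡 n)) (𝓡 n).tangent ∞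
      (fun p : ℝ × M => (⟨p.2, u p.1 p.2⟩ : TangentBundle (𝓡 n) M)) (J ×ˢ univ)) (p : M) :
    ContDiffOn ℝ ∞ (fun z : ℝ × 𝔼 => coordField (u z.1) p z.2) (J ×ˢ (φ p).target) := by
  have h1 : ContMDiffOn (𝓘(ℝ, ℝ).prod (𝓡 n)) 𝓘(ℝ, 𝔼) ∞
      (fun z : ℝ × M => chartDeriv p z.2 (u z.1 z.2)) (J ×ˢ (φ p).source) := by
    have h2 := (((trivializationAt 𝔼 (TangentSpace (𝓡 n)) p).contMDiffOn_iff (n := ∞)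
      (f := fun p : ℝ × M => (⟨p.2, u p.1 p.2⟩ : TangentBundle (𝓡 n) M))
      (s := J ×ˢ (φ p).source) (IM := 𝓘(ℝ, ℝ).prod (𝓡 n)) (IB := 𝓡 n) ?_).1
      (hu.mono (prod_mono_right (subset_univ _)))).2
    · refine h2.congr fun z hz => ?_
      unfold chartDeriv
      rw [Bundle.Trivialization.continuousLinearMapAt_apply,
        Bundle.Trivialization.coe_linearMapAt_of_mem _ (mem_baseSet hz.2)]
    · intro z hz
      rw [Bundle.Trivialization.mem_source]
      exact mem_baseSet hz.2
  rw [← contMDiffOn_iff_contDiffOn]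
  have h3 : ContMDiffOn 𝓘(ℝ, ℝ × 𝔼) (𝓘(ℝ, ℝ).prod (𝓡 n)) ∞
      (fun z : ℝ × 𝔼 => (z.1, (φ p).symm z.2)) (J ×ˢ (φ p).target) := by
    refine ContMDiffOn.prodMk (contDiff_fst.contMDiff.contMDiffOn) ?_
    exact (contMDiffOn_extChartAt_symm p).comp contDiff_snd.contMDiff.contMDiffOn
      fun z hz => hz.2
  refine (h1.comp h3 fun z hz => ⟨hz.1, (φ p).map_target hz.2⟩).congr fun z hz => ?_
  exact coordField_eq _ hz.2

theorem contDiffOn_transition (p q : M) : ContDiffOn ℝ ∞ (transition p q) (overlap (n := n) p q) := by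
  rw [← contMDiffOn_iff_contDiffOn]
  refine ContMDiffOn.comp (t := (φ q).source) (I' := 𝓡 n) ?_
    ((contMDiffOn_extChartAt_symm p).mono inter_subset_left) fun y hy => hy.2
  simpa using contMDiffOn_extChartAt (I := 𝓡 n) (n := ∞) (x := q)

theorem fderiv_transition {p q : M} {y : 𝔼} (hy : y ∈ overlap (n := n) p q) :
    fderiv ℝ (transition p q) y
      = (chartDeriv q ((φ p).symm y) ∘L chartFrame p ((φ p).symm y) : 𝔼 →L[ℝ] 𝔼) := by
  have h1 : MDifferentiableAt (𝓡 n) (𝓡 n) (φ q) ((φ p).symm y) :=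
    mdifferentiableAt_extChartAt (by simpa using hy.2)
  have h2 : MDifferentiableAt (𝓡 n) (𝓡 n) (φ p).symm y := by
    have := mdifferentiableWithinAt_extChartAt_symm (I := 𝓡 n) hy.1
    rwa [ModelWithCorners.range_eq_univ, mdifferentiableWithinAt_univ] at this
  have h := mfderiv_comp y h1 h2
  rw [mfderiv_chart hy.2, mfderiv_chart_symm hy.1, mfderiv_eq_fderiv] at h
  exact h

/-- The differential of the reverse transition is a right inverse, and determinants multiply. -/
theorem det_fderiv_transition_ne_zero {p q : M} {y : 𝔼} (hy : y ∈ overlap (n := n) p q) :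
    (fderiv ℝ (transition p q) y).det ≠ 0 := by
  rw [fderiv_transition hy]
  have hp : (φ p).symm y ∈ (φ p).source := (φ p).map_target hy.1
  set x := (φ p).symm y
  have h : (chartDeriv q x ∘L chartFrame p x : 𝔼 →L[ℝ] 𝔼)
      ∘L (chartDeriv p x ∘L chartFrame q x : 𝔼 →L[ℝ] 𝔼) = ContinuousLinearMap.id ℝ 𝔼 := by
    ext1 v
    simp only [ContinuousLinearMap.comp_apply, chartFrame_chartDeriv hp]
    exact chartDeriv_chartFrame hy.2 v
  intro h0
  have h1 := congrArg ContinuousLinearMap.det h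
  have h2 : ((chartDeriv q x ∘L chartFrame p x : 𝔼 →L[ℝ] 𝔼)
      ∘L (chartDeriv p x ∘L chartFrame q x : 𝔼 →L[ℝ] 𝔼)).det
      = (chartDeriv q x ∘L chartFrame p x : 𝔼 →L[ℝ] 𝔼).det *
        (chartDeriv p x ∘L chartFrame q x : 𝔼 →L[ℝ] 𝔼).det := LinearMap.det_comp _ _
  rw [h2, h0, zero_mul] at h1
  have h3 : (ContinuousLinearMap.id ℝ 𝔼).det = 1 := LinearMap.det_id
  rw [h3] at h1
  exact zero_ne_one h1

theorem chartDensity_transition (g : RiemMetric n M) {p q : M} {y : 𝔼}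
    (hy : y ∈ overlap (n := n) p q) :
    chartDensity g p y
      = |(fderiv ℝ (transition p q) y).det| * chartDensity g q (transition p q y) := by
  rw [fderiv_transition hy]
  have h := boxVolume_comp g hy.2 (chartFrame p ((φ p).symm y))
  refine Eq.trans ?_ h
  unfold chartDensity
  rw [coordVec_eq hy.1]

theorem coordField_transition (u : (x : M) → TangentSpace (𝓡 n) x) {p q : M} {y : 𝔼}
    (hy : y ∈ overlap (n := n) p q) :
    coordField u q (transition p q y) = fderiv ℝ (transition p q) y (coordField u p y) := by
  rw [fderiv_transition hy, coordField_eq u hy.1]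
  unfold transition
  rw [coordField_chart u hy.2]
  rw [ContinuousLinearMap.comp_apply, chartFrame_chartDeriv ((φ p).map_target hy.1)]

theorem differentiableAt_chartDensity (g : RiemMetric n M)
    {p : M} {y : 𝔼} (hy : y ∈ (φ p).target) : DifferentiableAt ℝ (chartDensity g p) y :=
  ((contDiffOn_chartDensity g p).contDiffAt ((isOpen_chart_target p).mem_nhds hy)).differentiableAt
    (by simp)

/-- The divergence can be computed in every chart. -/
theorem divergence_eq_weightedDiv (g : RiemMetric n M) {u : (x : M) → TangentSpace (𝓡 n) x}
    (hu : IsSmoothField u) {p x : M} (hx : x ∈ (φ p).source) :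
    divergence g u x = weightedDiv (chartDensity g p) (coordField u p) (φ p x) := by
  have hxx : x ∈ (φ x).source := mem_extChartAt_source x
  have hy : φ x x ∈ overlap (n := n) x p := by
    refine ⟨(φ x).map_source hxx, ?_⟩
    rw [mem_preimage, (φ x).left_inv hxx]
    exact hx
  have hnhds : ∀ᶠ z in nhds (φ x x), z ∈ overlap (n := n) x p := (isOpen_overlap x p).mem_nhds hy
  have hψ : transition x p (φ x x) = φ p x := by
    unfold transition
    rw [(φ x).left_inv hxx]
  have hpx : φ p x ∈ (φ p).target := (φ p).map_source hx
  have h := weightedDiv_change (ψ := transition x p) (w := chartDensity g x)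
    (v := chartDensity g p) (X := coordField u x) (Y := coordField u p) (y := φ x x)
    (((contDiffOn_transition x p).contDiffAt ((isOpen_overlap x p).mem_nhds hy)).of_le
      (by norm_cast))
    (det_fderiv_transition_ne_zero hy)
    (hnhds.mono fun z hz => coordField_transition u hz)
    (hnhds.mono fun z hz => chartDensity_transition g hz)
    (differentiableAt_chartDensity g hy.1)
    (by rw [hψ]; exact differentiableAt_chartDensity g hpx)
    (by rw [hψ]; exact (chartDensity_pos g hpx).ne')
    (hu.differentiableAt hy.1) (by rw [hψ]; exact hu.differentiableAt hpx)
  rw [hψ] at h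
  exact h

end Charts

/-! ### The Riemannian volume measure -/

section Volume

variable {n : ℕ} {M : Type*} [TopologicalSpace M]
  [ChartedSpace (EuclideanSpace ℝ (Fin n)) M]

local notation "𝔼" => EuclideanSpace ℝ (Fin n)
local notation "φ" => extChartAt (M := M) (𝓡 n)

theorem measurableSet_chart_preimage [MeasurableSpace M] [BorelSpace M] (p : M) {A : Set M} (hA : MeasurableSet A) :
    MeasurableSet ((φ p).symm ⁻¹' A ∩ (φ p).target) := by
  have h := (continuousOn_iff_continuous_domRestrict.1
    (continuousOn_extChartAt_symm (I := 𝓡 n) p)).measurable hA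
  have h2 := (isOpen_chart_target (n := n) p).measurableSet.subtype_image h
  convert h2 using 1
  ext y
  constructor
  · rintro ⟨h1, h2⟩
    exact ⟨⟨y, h2⟩, h1, rfl⟩
  · rintro ⟨⟨z, hz⟩, h1, rfl⟩
    exact ⟨h1, hz⟩

variable [IsManifold (𝓡 n) ∞ M]

theorem continuousOn_chartDensity (g : RiemMetric n M) (p : M) :
    ContinuousOn (chartDensity g p) (φ p).target := (contDiffOn_chartDensity g p).continuousOn

variable [MeasurableSpace M]

theorem chartMeasure_le_volumeMeasure (g : RiemMetric n M) (p : M) :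
    chartMeasure g p ≤ volumeMeasure g := le_iSup (fun p => chartMeasure g p) p

variable [BorelSpace M]

theorem aemeasurable_chart_symm (g : RiemMetric n M) (p : M) :
    AEMeasurable (φ p).symm (((volume : Measure 𝔼).restrict (φ p).target).withDensity
      fun y => ENNReal.ofReal (chartDensity g p y)) :=
  ((continuousOn_extChartAt_symm (I := 𝓡 n) p).aemeasurable
    (isOpen_chart_target (n := n) p).measurableSet).mono_ac (withDensity_absolutelyContinuous _ _)

theorem chartMeasure_apply (g : RiemMetric n M) (p : M) {A : Set M} (hA : MeasurableSet A) :
    chartMeasure g p A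
      = ∫⁻ y in (φ p).symm ⁻¹' A ∩ (φ p).target, ENNReal.ofReal (chartDensity g p y) := by
  unfold chartMeasure
  rw [Measure.map_apply_of_aemeasurable (aemeasurable_chart_symm g p) hA, withDensity_apply',
    Measure.restrict_restrict' (isOpen_chart_target (n := n) p).measurableSet]

theorem chartMeasure_compl_source (g : RiemMetric n M) (p : M) :
    chartMeasure g p (φ p).sourceᶜ = 0 := by
  rw [chartMeasure_apply g p (isOpen_chart_source (n := n) p).measurableSet.compl]
  have : (φ p).symm ⁻¹' (φ p).sourceᶜ ∩ (φ p).target = ∅ := by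
    ext y
    simp only [mem_inter_iff, mem_preimage, mem_compl_iff, mem_empty_iff_false, iff_false, not_and]
    exact fun h hy => h ((φ p).map_target hy)
  rw [this]
  simp

theorem chartMeasure_inter_source (g : RiemMetric n M) (p : M) (A : Set M) :
    chartMeasure g p (A ∩ (φ p).source) = chartMeasure g p A :=
  measure_inter_conull (chartMeasure_compl_source g p)

/-- The chart measures agree on the overlaps of the chart domains. -/
theorem chartMeasure_eq_of_subset (g : RiemMetric n M) {p q : M} {A : Set M} (hA : MeasurableSet A)
    (hp : A ⊆ (φ p).source) (hq : A ⊆ (φ q).source) : chartMeasure g p A = chartMeasure g q A := by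
  rw [chartMeasure_apply g p hA, chartMeasure_apply g q hA]
  set S := (φ p).symm ⁻¹' A ∩ (φ p).target with hS
  have hSo : S ⊆ overlap (n := n) p q := fun y hy => ⟨hy.2, hq hy.1⟩
  have himage : transition p q '' S = (φ q).symm ⁻¹' A ∩ (φ q).target := by
    ext z
    constructor
    · rintro ⟨y, hy, rfl⟩
      refine ⟨?_, (φ q).map_source (hq hy.1)⟩
      rw [mem_preimage, transition, (φ q).left_inv (hq hy.1)]
      exact hy.1
    · rintro ⟨h1, h2⟩
      refine ⟨φ p ((φ q).symm z), ⟨?_, (φ p).map_source (hp h1)⟩, ?_⟩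
      · rw [mem_preimage, (φ p).left_inv (hp h1)]
        exact h1
      · rw [transition, (φ p).left_inv (hp h1), (φ q).right_inv h2]
  have hinj : InjOn (transition (n := n) p q) S := by
    intro y hy z hz h
    have := congrArg (φ q).symm h
    unfold transition at this
    rw [(φ q).left_inv (hq hy.1), (φ q).left_inv (hq hz.1)] at this
    rw [← (φ p).right_inv hy.2, this, (φ p).right_inv hz.2]
  rw [← himage, lintegral_image_eq_lintegral_abs_det_fderiv_mul volume
    (measurableSet_chart_preimage (n := n) p hA) (f' := fderiv ℝ (transition p q)) ?_ hinj]
  · refine setLIntegral_congr_fun (measurableSet_chart_preimage (n := n) p hA) fun y hy => ?_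
    rw [chartDensity_transition g (hSo hy), ENNReal.ofReal_mul (abs_nonneg _)]
  · intro y hy
    exact ((((contDiffOn_transition p q).contDiffAt ((isOpen_overlap p q).mem_nhds
      (hSo hy))).differentiableAt (by simp)).hasFDerivAt).hasFDerivWithinAt

variable [CompactSpace M]

/-- The supremum adds no mass: cut M into countably many disjoint pieces lying in chart domains and
let ν be the sum of the chart measures restricted to them. Agreement on overlaps gives chartMeasure
g q ≤ ν for every q, and ν A = chartMeasure g p A when A lies in the chart at p. -/
theorem volumeMeasure_apply_of_subset (g : RiemMetric n M) {p : M} {A : Set M}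
    (hA : MeasurableSet A) (hp : A ⊆ (φ p).source) :
    volumeMeasure g A = chartMeasure g p A := by
  have := ChartedSpace.secondCountable_of_sigmaCompact 𝔼 M
  refine le_antisymm ?_ (chartMeasure_le_volumeMeasure g p A)
  obtain ⟨s, hs, hcov⟩ := TopologicalSpace.countable_cover_nhds
    fun x : M => extChartAt_source_mem_nhds (I := 𝓡 n) x
  have hsn : s.Nonempty := by
    by_contra h
    rw [not_nonempty_iff_eq_empty] at h
    rw [h] at hcov
    simpa using (hcov.symm ▸ mem_univ p : p ∈ ⋃ x ∈ (∅ : Set M), (φ x).source)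
  obtain ⟨c, rfl⟩ := hs.exists_eq_range hsn
  rw [biUnion_range] at hcov
  set D : ℕ → Set M := disjointed fun i => (φ (c i)).source with hD
  have hDm : ∀ i, MeasurableSet (D i) := fun i =>
    MeasurableSet.disjointed (fun i => (isOpen_chart_source (n := n) (c i)).measurableSet) i
  have hDs : ∀ i, D i ⊆ (φ (c i)).source := fun i => disjointed_subset _ i
  have hDu : ⋃ i, D i = univ := by rw [hD, iUnion_disjointed, hcov]
  have hsplit : ∀ (m : Measure M) {B : Set M}, MeasurableSet B → m B = ∑' i, m (B ∩ D i) := by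
    intro m B hB
    rw [← measure_iUnion (fun i j hij => (disjoint_disjointed _ hij).mono
      inter_subset_right inter_subset_right) fun i => hB.inter (hDm i), ← inter_iUnion, hDu,
      inter_univ]
  let ν : Measure M := Measure.sum fun i => (chartMeasure g (c i)).restrict (D i)
  have hν : ∀ {B : Set M}, MeasurableSet B → ν B = ∑' i, chartMeasure g (c i) (B ∩ D i) := by
    intro B hB
    rw [Measure.sum_apply _ hB]
    exact tsum_congr fun i => Measure.restrict_apply hB
  have hle : volumeMeasure g ≤ ν := by
    refine iSup_le fun q => Measure.le_iff.2 fun B hB => ?_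
    rw [hsplit _ hB, hν hB]
    refine ENNReal.tsum_le_tsum fun i => ?_
    rw [← chartMeasure_inter_source, chartMeasure_eq_of_subset (q := c i) g
      ((hB.inter (hDm i)).inter (isOpen_chart_source (n := n) q).measurableSet)
      inter_subset_right fun x hx => hDs i hx.1.2]
    exact measure_mono inter_subset_left
  refine (hle A).trans_eq ?_
  rw [hν hA, hsplit _ hA]
  exact tsum_congr fun i => (chartMeasure_eq_of_subset g (hA.inter (hDm i))
    (fun x hx => hp hx.1) fun x hx => hDs i hx.2).symm

theorem volumeMeasure_restrict (g : RiemMetric n M) (p : M) :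
    (volumeMeasure g).restrict (φ p).source = chartMeasure g p := by
  refine Measure.ext fun A hA => ?_
  rw [Measure.restrict_apply hA, volumeMeasure_apply_of_subset g (p := p)
    (hA.inter (isOpen_chart_source (n := n) p).measurableSet) inter_subset_right,
    chartMeasure_inter_source]

instance isLocallyFiniteMeasure_volumeMeasure (g : RiemMetric n M) :
    IsLocallyFiniteMeasure (volumeMeasure g) := by
  refine ⟨fun x => ?_⟩
  obtain ⟨K, hK, hxK, hKt⟩ := exists_compact_subset (isOpen_chart_target (n := n) x)
    (mem_extChartAt_target (I := 𝓡 n) x)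
  have ho : IsOpen ((φ x).source ∩ φ x ⁻¹' interior K) :=
    (continuousOn_extChartAt x).isOpen_inter_preimage (isOpen_chart_source (n := n) x)
      isOpen_interior
  refine ⟨_, ho.mem_nhds ⟨mem_extChartAt_source x, hxK⟩, ?_⟩
  rw [volumeMeasure_apply_of_subset g ho.measurableSet inter_subset_left,
    chartMeasure_apply g x ho.measurableSet]
  have hint : IntegrableOn (chartDensity g x) K :=
    ((continuousOn_chartDensity g x).mono hKt).integrableOn_compact hK
  refine (lintegral_mono_set ?_).trans_lt hint.lintegral_lt_top
  rintro y ⟨⟨_, h2⟩, h3⟩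
  rw [mem_preimage, (φ x).right_inv h3] at h2
  exact interior_subset h2

instance isFiniteMeasure_volumeMeasure (g : RiemMetric n M) :
    IsFiniteMeasure (volumeMeasure g) := inferInstance

instance isOpenPosMeasure_volumeMeasure (g : RiemMetric n M) :
    (volumeMeasure g).IsOpenPosMeasure := by
  refine ⟨fun U hU ⟨x, hx⟩ h0 => ?_⟩
  have ho : IsOpen (U ∩ (φ x).source) := hU.inter (isOpen_chart_source (n := n) x)
  have h1 : volumeMeasure g (U ∩ (φ x).source) = 0 := measure_mono_null inter_subset_left h0
  rw [volumeMeasure_apply_of_subset g ho.measurableSet inter_subset_right,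
    chartMeasure_apply g x ho.measurableSet] at h1
  set S := (φ x).symm ⁻¹' (U ∩ (φ x).source) ∩ (φ x).target with hS
  have hSm : MeasurableSet S := measurableSet_chart_preimage (n := n) x ho.measurableSet
  have hSo : IsOpen S := by
    rw [hS, inter_comm]
    exact (continuousOn_extChartAt_symm x).isOpen_inter_preimage (isOpen_chart_target (n := n) x) ho
  have hxs : x ∈ (φ x).source := mem_extChartAt_source x
  have hSn : S.Nonempty := ⟨φ x x, by
    refine ⟨?_, (φ x).map_source hxs⟩
    rw [mem_preimage, (φ x).left_inv hxs]
    exact ⟨hx, hxs⟩⟩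
  rw [lintegral_eq_zero_iff' (((continuousOn_chartDensity g x).mono
    inter_subset_right).aemeasurable hSm).ennreal_ofReal] at h1
  have h2 : ∀ᵐ y ∂(volume : Measure 𝔼).restrict S, False := by
    filter_upwards [h1, ae_restrict_mem hSm] with y h3 h4
    have := chartDensity_pos g h4.2
    simp only [Pi.zero_apply, ENNReal.ofReal_eq_zero] at h3
    linarith
  rw [Filter.eventually_false_iff_eq_bot, ae_eq_bot, Measure.restrict_eq_zero] at h2
  exact (hSo.measure_pos volume hSn).ne' h2

theorem setIntegral_chart_source (g : RiemMetric n M) (p : M) {f : M → ℝ} (hf : Continuous f) :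
    ∫ x in (φ p).source, f x ∂volumeMeasure g
      = ∫ y in (φ p).target, chartDensity g p y * f ((φ p).symm y) := by
  have := ChartedSpace.secondCountable_of_sigmaCompact 𝔼 M
  rw [volumeMeasure_restrict, chartMeasure,
    integral_map (aemeasurable_chart_symm g p) hf.aestronglyMeasurable,
    integral_withDensity_eq_integral_toReal_smul₀]
  · refine setIntegral_congr_fun (isOpen_chart_target (n := n) p).measurableSet fun y hy => ?_
    simp only [smul_eq_mul]
    rw [ENNReal.toReal_ofReal (chartDensity_pos g hy).le]
  · exact ((continuousOn_chartDensity g p).aemeasurable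
      (isOpen_chart_target (n := n) p).measurableSet).ennreal_ofReal
  · exact Filter.Eventually.of_forall fun y => ENNReal.ofReal_lt_top

end Volume

/-! ### Space and time slices of functions on J × O -/

section Slices

variable {n : ℕ}

local notation "𝔼" => EuclideanSpace ℝ (Fin n)

/-- Even at an endpoint of J the spatial derivative is a genuine one, because O is open. -/
theorem hasFDerivAt_slice {F : Type*} [NormedAddCommGroup F] [NormedSpace ℝ F] {J : Set ℝ}
    {O : Set 𝔼} (hO : IsOpen O) {f : ℝ × 𝔼 → F} {t : ℝ} {y : 𝔼} (ht : t ∈ J) (hy : y ∈ O)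
    (hf : DifferentiableWithinAt ℝ f (J ×ˢ O) (t, y)) :
    HasFDerivAt (fun z => f (t, z))
      (fderivWithin ℝ f (J ×ˢ O) (t, y) ∘L ContinuousLinearMap.inr ℝ ℝ 𝔼) y := by
  have h := hf.hasFDerivWithinAt.comp y (hasFDerivAt_prodMk_right t y).hasFDerivWithinAt
    (s := O) fun z hz => ⟨ht, hz⟩
  exact h.hasFDerivAt (hO.mem_nhds hy)

theorem hasDerivWithinAt_slice {F : Type*} [NormedAddCommGroup F] [NormedSpace ℝ F] {J : Set ℝ}
    {O : Set 𝔼} {f : ℝ × 𝔼 → F} {t : ℝ} {y : 𝔼} (hy : y ∈ O)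
    (hf : DifferentiableWithinAt ℝ f (J ×ˢ O) (t, y)) :
    HasDerivWithinAt (fun s => f (s, y)) (fderivWithin ℝ f (J ×ˢ O) (t, y) (1, 0)) J t := by
  have h1 : HasDerivWithinAt (fun s : ℝ => (s, y)) ((1 : ℝ), (0 : 𝔼)) J t :=
    (hasDerivWithinAt_id t J).prodMk (hasDerivWithinAt_const t J y)
  exact HasFDerivWithinAt.comp_hasDerivWithinAt_of_eq t hf.hasFDerivWithinAt h1
    (fun s hs => ⟨hs, hy⟩ : MapsTo (fun s : ℝ => (s, y)) J (J ×ˢ O)) rfl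

/-- The divergence in coordinates of a smooth time-dependent field is a smooth function. -/
theorem contDiffOn_weightedDiv {J : Set ℝ} (hJ : UniqueDiffOn ℝ J) {O : Set 𝔼} (hO : IsOpen O)
    {w : 𝔼 → ℝ} (hw : ContDiffOn ℝ ∞ w O) (hw0 : ∀ y ∈ O, w y ≠ 0) {V : ℝ → 𝔼 → 𝔼}
    (hV : ContDiffOn ℝ ∞ (fun z : ℝ × 𝔼 => V z.1 z.2) (J ×ˢ O)) :
    ContDiffOn ℝ ∞ (fun z : ℝ × 𝔼 => weightedDiv w (V z.1) z.2) (J ×ˢ O) := by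
  have hw' : ContDiffOn ℝ ∞ (fun z : ℝ × 𝔼 => w z.2) (J ×ˢ O) :=
    hw.comp contDiff_snd.contDiffOn fun z hz => hz.2
  have hU : UniqueDiffOn ℝ (J ×ˢ O) := hJ.prod hO.uniqueDiffOn
  unfold weightedDiv
  refine (hw'.inv fun z hz => hw0 _ hz.2).mul (ContDiffOn.sum fun i _ => ?_)
  have hF : ContDiffOn ℝ ∞ (fun z : ℝ × 𝔼 => w z.2 * V z.1 z.2 i) (J ×ˢ O) :=
    hw'.mul ((EuclideanSpace.proj i : 𝔼 →L[ℝ] ℝ).contDiff.comp_contDiffOn hV)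
  refine ((hF.fderivWithin hU (m := ∞) (by simp)).clm_apply
    (contDiffOn_const (c := ((0 : ℝ), EuclideanSpace.single i (1 : ℝ))))).congr fun z hz => ?_
  rw [(hasFDerivAt_slice hO hz.1 hz.2
    ((hF z hz).differentiableWithinAt (by simp))).fderiv]
  simp

/-- The integral of the partial derivative of a compactly supported function vanishes. -/
theorem integral_fderiv_eq_zero {f : 𝔼 → ℝ} (hf : ContDiff ℝ 1 f) (hc : HasCompactSupport f)
    (v : 𝔼) : ∫ y, fderiv ℝ f y v = 0 := by
  have hcont : Continuous fun y => fderiv ℝ f y v :=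
    (hf.continuous_fderiv (by simp)).clm_apply continuous_const
  have hint : Integrable fun y => fderiv ℝ f y v :=
    hcont.integrable_of_hasCompactSupport (hc.fderiv_apply ℝ v)
  -- Integration by parts against the constant function 1.
  have h := integral_mul_fderiv_eq_neg_fderiv_mul_of_integrable (μ := (volume : Measure 𝔼))
    (f := fun _ => (1 : ℝ)) (g := f) (v := v) (by simp) (by simpa using hint)
    (by simpa using hf.continuous.integrable_of_hasCompactSupport hc)
    (fun x _ => differentiableAt_const _) fun x _ => hf.differentiable (by simp) x
  simpa using h

end Slices

/-! ### The divergence theorem on a closed manifold -/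

section DivergenceTheorem

variable {n : ℕ} {M : Type*} [TopologicalSpace M]
  [ChartedSpace (EuclideanSpace ℝ (Fin n)) M] [IsManifold (𝓡 n) ∞ M]

local notation "𝔼" => EuclideanSpace ℝ (Fin n)
local notation "φ" => extChartAt (M := M) (𝓡 n)

theorem advect_eq_fderiv (u : (x : M) → TangentSpace (𝓡 n) x) {f : M → ℝ} {q x : M}
    (hx : x ∈ (φ q).source) (hf : MDifferentiableAt (𝓡 n) 𝓘(ℝ, ℝ) f x) :
    advect u f x = fderiv ℝ (fun y => f ((φ q).symm y)) (φ q x) (coordField u q (φ q x)) := by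
  rw [fderiv_comp_chart_symm hx hf, coordField_chart u hx, chartFrame_chartDeriv hx]
  rfl

theorem IsSmoothField.smul {f : M → ℝ} (hf : ContMDiff (𝓡 n) 𝓘(ℝ, ℝ) ∞ f)
    {u : (x : M) → TangentSpace (𝓡 n) x} (hu : IsSmoothField u) :
    IsSmoothField fun x => f x • u x := by
  intro p
  have h1 : ContDiffOn ℝ ∞ (fun y => f ((φ p).symm y)) (φ p).target := by
    rw [← contMDiffOn_iff_contDiffOn]
    exact hf.comp_contMDiffOn (contMDiffOn_extChartAt_symm p)
  refine (h1.smul (hu p)).congr fun y hy => ?_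
  rw [coordField_eq _ hy, map_smul, Pi.smul_apply', coordField_eq _ hy]

/-- The divergence of a product. -/
theorem divergence_smul (g : RiemMetric n M) {f : M → ℝ} (hf : ContMDiff (𝓡 n) 𝓘(ℝ, ℝ) ∞ f)
    {u : (x : M) → TangentSpace (𝓡 n) x} (hu : IsSmoothField u) (x : M) :
    divergence g (fun x => f x • u x) x = f x * divergence g u x + advect u f x := by
  have hx : x ∈ (φ x).source := mem_extChartAt_source x
  have hy : φ x x ∈ (φ x).target := mem_extChartAt_target x
  have h1 : ContDiffOn ℝ ∞ (fun y => f ((φ x).symm y)) (φ x).target := by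
    rw [← contMDiffOn_iff_contDiffOn]
    exact hf.comp_contMDiffOn (contMDiffOn_extChartAt_symm x)
  have h2 : DifferentiableAt ℝ (fun y => f ((φ x).symm y)) (φ x x) :=
    (h1.contDiffAt ((isOpen_chart_target x).mem_nhds hy)).differentiableAt (by simp)
  have hd := differentiableAt_chartDensity g hy
  have hd0 := (chartDensity_pos g hy).ne'
  have hX := hu.differentiableAt hy
  have hev : coordField (fun x => f x • u x) x =ᶠ[nhds (φ x x)]
      fun y => f ((φ x).symm y) • coordField u x y := by
    filter_upwards [(isOpen_chart_target x).mem_nhds hy] with y hy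
    rw [coordField_eq _ hy, coordField_eq _ hy, map_smul]
  rw [divergence_eq_weightedDiv g (hu.smul hf) hx, divergence_eq_weightedDiv g hu hx,
    advect_eq_fderiv u hx (hf.mdifferentiableAt (by simp)),
    weightedDiv_congr Filter.EventuallyEq.rfl hev, weightedDiv_eq hd (h2.fun_smul hX) hd0,
    weightedDiv_eq hd hX hd0, trace_eq_sum_single, trace_eq_sum_single]
  have h3 : fderiv ℝ (fun y => f ((φ x).symm y) • coordField u x y) (φ x x)
      = f ((φ x).symm (φ x x)) • fderiv ℝ (coordField u x) (φ x x)
        + (fderiv ℝ (fun y => f ((φ x).symm y)) (φ x x)).smulRight (coordField u x (φ x x)) :=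
    (h2.hasFDerivAt.smul hX.hasFDerivAt).fderiv
  have h4 : fderiv ℝ (fun y => f ((φ x).symm y)) (φ x x) (coordField u x (φ x x))
      = ∑ i, fderiv ℝ (fun y => f ((φ x).symm y)) (φ x x) (EuclideanSpace.single i 1)
          * coordField u x (φ x x) i := by
    conv_lhs => rw [← sum_single_smul (coordField u x (φ x x))]
    simp [mul_comm]
  have h5 : ∀ i, fderiv ℝ (fun y => f ((φ x).symm y) • coordField u x y) (φ x x)
        (EuclideanSpace.single i 1) i
      = f x * fderiv ℝ (coordField u x) (φ x x) (EuclideanSpace.single i 1) i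
        + fderiv ℝ (fun y => f ((φ x).symm y)) (φ x x) (EuclideanSpace.single i 1)
          * coordField u x (φ x x) i := by
    intro i
    rw [h3, (φ x).left_inv hx]
    simp
  rw [h4, Finset.sum_congr rfl fun i _ => h5 i, Finset.sum_add_distrib, ← Finset.mul_sum,
    (φ x).left_inv hx, map_smul, smul_eq_mul]
  ring

theorem contMDiff_divergence (g : RiemMetric n M) {u : (x : M) → TangentSpace (𝓡 n) x}
    (hu : IsSmoothField u) : ContMDiff (𝓡 n) 𝓘(ℝ, ℝ) ∞ (divergence g u) := by
  intro x
  have h1 : ContDiffOn ℝ ∞ (fun z : ℝ × 𝔼 => coordField u x z.2) (univ ×ˢ (φ x).target) :=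
    (hu x).comp contDiff_snd.contDiffOn fun z hz => hz.2
  have h2 := contDiffOn_weightedDiv uniqueDiffOn_univ (isOpen_chart_target x)
    (contDiffOn_chartDensity g x) (fun y hy => (chartDensity_pos g hy).ne')
    (V := fun _ => coordField u x) h1
  have h3 : ContDiffOn ℝ ∞ (weightedDiv (chartDensity g x) (coordField u x)) (φ x).target :=
    h2.comp (f := fun y : 𝔼 => ((0 : ℝ), y)) (contDiff_const.prodMk contDiff_id).contDiffOn
      fun y hy => ⟨mem_univ _, hy⟩
  have h4 : ContMDiffOn (𝓡 n) 𝓘(ℝ, ℝ) ∞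
      (fun z => weightedDiv (chartDensity g x) (coordField u x) (φ x z)) (φ x).source := by
    refine h3.contMDiffOn.comp ?_ fun z hz => (φ x).map_source hz
    simpa using contMDiffOn_extChartAt (I := 𝓡 n) (n := ∞) (x := x)
  exact (h4.congr fun z hz => divergence_eq_weightedDiv g hu hz).contMDiffAt
    (extChartAt_source_mem_nhds x)

variable [MeasurableSpace M] [BorelSpace M] [CompactSpace M]

theorem integrable_of_continuous (g : RiemMetric n M) {f : M → ℝ} (hf : Continuous f) :
    Integrable f (volumeMeasure g) :=
  hf.integrable_of_hasCompactSupport (HasCompactSupport.of_compactSpace f)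

/-- In the chart the density of the measure cancels the factor 1/√det g of the divergence. What
remains is a sum of partial derivatives of compactly supported functions on Euclidean space. -/
theorem integral_divergence_smul_eq_zero [T2Space M] (g : RiemMetric n M) {f : M → ℝ}
    (hf : ContMDiff (𝓡 n) 𝓘(ℝ, ℝ) ∞ f) {p : M} (hfp : tsupport f ⊆ (φ p).source)
    {u : (x : M) → TangentSpace (𝓡 n) x} (hu : IsSmoothField u) :
    ∫ x, divergence g (fun x => f x • u x) x ∂volumeMeasure g = 0 := by
  set Y : (x : M) → TangentSpace (𝓡 n) x := fun x => f x • u x with hY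
  have hYs : IsSmoothField Y := hu.smul hf
  have hout : ∀ x, x ∉ tsupport f → divergence g Y x = 0 := by
    intro x hx
    have h1 : f =ᶠ[nhds x] fun _ => 0 := notMem_tsupport_iff_eventuallyEq.1 hx
    have h2 : advect u f x = 0 := by
      unfold advect
      rw [h1.mfderiv_eq, mfderiv_const]
      rfl
    rw [hY, divergence_smul g hf hu, h1.eq_of_nhds, h2]
    simp
  set T := (φ p).target with hT
  have hTo : IsOpen T := isOpen_chart_target p
  set K : Set 𝔼 := φ p '' tsupport f with hK
  have hKc : IsCompact K := (isClosed_tsupport f).isCompact.image_of_continuousOn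
    ((continuousOn_extChartAt p).mono hfp)
  have hKT : K ⊆ T := by
    rintro _ ⟨x, hx, rfl⟩
    exact (φ p).map_source (hfp hx)
  -- Extension by zero is C¹: V i is smooth on the open set T and vanishes off the compact set K ⊆
  -- T.
  let V : Fin n → 𝔼 → ℝ := fun i =>
    T.indicator fun y => chartDensity g p y * coordField Y p y i
  have hVT : ∀ i, ∀ y ∈ T, V i =ᶠ[nhds y] fun y => chartDensity g p y * coordField Y p y i := by
    intro i y hy
    filter_upwards [hTo.mem_nhds hy] with z hz
    exact indicator_of_mem hz _
  have hVK : ∀ i y, y ∉ K → V i y = 0 := by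
    intro i y hy
    by_cases hyT : y ∈ T
    · have h1 : (φ p).symm y ∉ tsupport f := fun h => hy ⟨_, h, (φ p).right_inv hyT⟩
      have h2 : f ((φ p).symm y) = 0 := image_eq_zero_of_notMem_tsupport h1
      have h3 : coordField Y p y = 0 := by
        rw [coordField_eq _ hyT, hY]
        simp only [h2, zero_smul, map_zero]
      simp only [V, indicator_of_mem hyT, h3]
      simp
    · exact indicator_of_notMem hyT _
  have hVc : ∀ i, HasCompactSupport (V i) := fun i => HasCompactSupport.intro hKc (hVK i)
  have hVs : ∀ i, ContDiff ℝ 1 (V i) := by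
    intro i
    rw [contDiff_iff_contDiffAt]
    intro y
    by_cases hyT : y ∈ T
    · refine ContDiffAt.congr_of_eventuallyEq ?_ (hVT i y hyT)
      have h1 : ContDiffOn ℝ ∞ (fun y => chartDensity g p y * coordField Y p y i) T :=
        (contDiffOn_chartDensity g p).mul
          ((EuclideanSpace.proj i : 𝔼 →L[ℝ] ℝ).contDiff.comp_contDiffOn (hYs p))
      exact (h1.contDiffAt (hTo.mem_nhds hyT)).of_le (by norm_cast)
    · have h1 : V i =ᶠ[nhds y] fun _ => 0 := by
        filter_upwards [hKc.isClosed.isOpen_compl.mem_nhds fun h => hyT (hKT h)] with z hz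
        exact hVK i z hz
      exact contDiffAt_const.congr_of_eventuallyEq h1
  rw [← setIntegral_eq_integral_of_forall_compl_eq_zero (s := (φ p).source)
    fun x hx => hout x fun h => hx (hfp h),
    setIntegral_chart_source g p (contMDiff_divergence g hYs).continuous]
  have h1 : ∀ y ∈ T, chartDensity g p y * divergence g Y ((φ p).symm y)
      = ∑ i, fderiv ℝ (V i) y (EuclideanSpace.single i 1) := by
    intro y hy
    rw [divergence_eq_weightedDiv g hYs ((φ p).map_target hy), (φ p).right_inv hy, weightedDiv,
      mul_inv_cancel_left₀ (chartDensity_pos g hy).ne']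
    exact Finset.sum_congr rfl fun i _ => by rw [(hVT i y hy).fderiv_eq]
  rw [setIntegral_congr_fun hTo.measurableSet h1,
    setIntegral_eq_integral_of_forall_compl_eq_zero]
  · rw [integral_finsetSum]
    · exact Finset.sum_eq_zero fun i _ => integral_fderiv_eq_zero (hVs i) (hVc i) _
    · intro i _
      exact (((hVs i).continuous_fderiv (by simp)).clm_apply
        continuous_const).integrable_of_hasCompactSupport ((hVc i).fderiv_apply ℝ _)
  · intro y hy
    refine Finset.sum_eq_zero fun i _ => ?_
    have h1 : V i =ᶠ[nhds y] fun _ => 0 := by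
      filter_upwards [hKc.isClosed.isOpen_compl.mem_nhds fun h => hy (hKT h)] with z hz
      exact hVK i z hz
    rw [h1.fderiv_eq]
    simp

/-- The divergence theorem on a closed Riemannian manifold. -/
theorem integral_divergence_eq_zero [T2Space M] (g : RiemMetric n M)
    {u : (x : M) → TangentSpace (𝓡 n) x} (hu : IsSmoothField u) :
    ∫ x, divergence g u x ∂volumeMeasure g = 0 := by
  obtain ⟨t, ht⟩ := (isCompact_univ (X := M)).elim_finite_subcover
    (fun p : M => (φ p).source) (fun p => isOpen_chart_source p)
    fun x _ => mem_iUnion.2 ⟨x, mem_extChartAt_source x⟩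
  obtain ⟨χ, hχ⟩ := SmoothPartitionOfUnity.exists_isSubordinate (𝓡 n) (s := (univ : Set M))
    isClosed_univ (fun p : t => (φ (p : M)).source) (fun p => isOpen_chart_source _)
    (by
      intro x hx
      obtain ⟨p, hp, hxp⟩ := mem_iUnion₂.1 (ht hx)
      exact mem_iUnion.2 ⟨⟨p, hp⟩, hxp⟩)
  have hχs : ∀ p : t, ContMDiff (𝓡 n) 𝓘(ℝ, ℝ) ∞ (χ p) := fun p => (χ p).contMDiff
  have hsum : ∀ x, ∑ p : t, χ p x = 1 := by
    intro x
    rw [← finsum_eq_sum_of_fintype]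
    exact χ.sum_eq_one (mem_univ x)
  -- The functions χ p sum to the constant 1, so the gradient terms of the product rule cancel in
  -- the sum.
  have hadv : ∀ x, ∑ p : t, advect u (χ p) x = 0 := by
    intro x
    have hx : x ∈ (φ x).source := mem_extChartAt_source x
    have hy : φ x x ∈ (φ x).target := mem_extChartAt_target x
    have h1 : ∀ p : t, advect u (χ p) x
        = fderiv ℝ (fun y => χ p ((φ x).symm y)) (φ x x) (coordField u x (φ x x)) := fun p =>
      advect_eq_fderiv u hx ((hχs p).mdifferentiableAt (by simp))
    have h2 : ∀ p ∈ (Finset.univ : Finset t),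
        DifferentiableAt ℝ (fun y => χ p ((φ x).symm y)) (φ x x) := by
      intro p _
      have h1 : ContDiffOn ℝ ∞ (fun y => χ p ((φ x).symm y)) (φ x).target := by
        rw [← contMDiffOn_iff_contDiffOn]
        exact (hχs p).comp_contMDiffOn (contMDiffOn_extChartAt_symm x)
      exact (h1.contDiffAt ((isOpen_chart_target x).mem_nhds hy)).differentiableAt (by simp)
    have h3 := fderiv_fun_sum h2
    simp only [hsum, fderiv_fun_const, Pi.zero_apply] at h3
    rw [Finset.sum_congr rfl fun p _ => h1 p, ← sum_apply, ← h3]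
    rfl
  have hdiv : ∀ x, divergence g u x = ∑ p : t, divergence g (fun x => χ p x • u x) x := by
    intro x
    rw [Finset.sum_congr rfl fun p _ => divergence_smul g (hχs p) hu x, Finset.sum_add_distrib,
      ← Finset.sum_mul, hsum, hadv, one_mul, add_zero]
  rw [integral_congr_ae (Filter.Eventually.of_forall hdiv), integral_finsetSum]
  · exact Finset.sum_eq_zero fun p _ =>
      integral_divergence_smul_eq_zero g (hχs p) (hχ p) hu
  · exact fun p _ => integrable_of_continuous g
      (contMDiff_divergence g (hu.smul (hχs p))).continuous

end DivergenceTheorem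

/-! ### The variational equation of a flow in coordinates -/

section Variational

variable {n : ℕ}

local notation "𝔼" => EuclideanSpace ℝ (Fin n)

theorem interior_nonempty_of_ordConnected {J : Set ℝ} (hJ : J.OrdConnected)
    (hJn : J.Nontrivial) : (interior J).Nonempty := by
  obtain ⟨a, ha, b, hb, hab⟩ := hJn.exists_lt
  obtain ⟨c, hc⟩ := nonempty_Ioo.2 hab
  exact ⟨c, interior_maximal (Ioo_subset_Icc_self.trans (hJ.out ha hb)) isOpen_Ioo hc⟩

theorem uniqueDiffOn_of_ordConnected {J : Set ℝ} (hJ : J.OrdConnected) (hJn : J.Nontrivial) :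
    UniqueDiffOn ℝ J := 
  uniqueDiffOn_convex hJ.convex (interior_nonempty_of_ordConnected hJ hJn)

theorem subset_closure_interior_of_ordConnected {J : Set ℝ} (hJ : J.OrdConnected)
    (hJn : J.Nontrivial) : J ⊆ closure (interior J) := by
  rw [(Set.OrdConnected.convex (𝕜 := ℝ) hJ).closure_interior_eq_closure_of_nonempty_interior
    (interior_nonempty_of_ordConnected hJ hJn)]
  exact subset_closure

/-- The linearization of a flow solves the linearized equation. -/
theorem hasDerivWithinAt_fderiv_flow {J : Set ℝ} (hJ : UniqueDiffOn ℝ J) {t : ℝ} (ht : t ∈ J)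
    (htc : t ∈ closure (interior J)) {O : Set 𝔼} (hO : IsOpen O) {y : 𝔼} (hy : y ∈ O)
    {H : ℝ × 𝔼 → 𝔼} (hH : ContDiffOn ℝ ∞ H (J ×ˢ O)) {V : 𝔼 → 𝔼}
    (hV : DifferentiableAt ℝ V (H (t, y)))
    (hflow : ∀ z ∈ O, HasDerivWithinAt (fun s => H (s, z)) (V (H (t, z))) J t) :
    HasDerivWithinAt (fun s => fderiv ℝ (fun z => H (s, z)) y)
      (fderiv ℝ V (H (t, y)) ∘L fderiv ℝ (fun z => H (t, z)) y) J t := by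
  have hU : UniqueDiffOn ℝ (J ×ˢ O) := hJ.prod hO.uniqueDiffOn
  have hdH : ∀ {s z}, s ∈ J → z ∈ O → DifferentiableWithinAt ℝ H (J ×ˢ O) (s, z) :=
    fun hs hz => (hH _ ⟨hs, hz⟩).differentiableWithinAt (by simp)
  set D := fderivWithin ℝ H (J ×ˢ O) with hD
  have hDs : ContDiffOn ℝ ∞ D (J ×ˢ O) := hH.fderivWithin hU (m := ∞) (by simp)
  have hdD : DifferentiableWithinAt ℝ D (J ×ˢ O) (t, y) :=
    (hDs _ ⟨ht, hy⟩).differentiableWithinAt (by simp)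
  -- Time and space derivatives commute even when t is an endpoint of J, since (t, y) lies in the
  -- closure of the interior of J × O.
  have hsymm : IsSymmSndFDerivWithinAt ℝ H (J ×ˢ O) (t, y) := by
    refine (hH _ ⟨ht, hy⟩).isSymmSndFDerivWithinAt (by simp; norm_cast) hU ?_ ⟨ht, hy⟩
    rw [interior_prod_eq, closure_prod_eq, hO.interior_eq]
    exact ⟨htc, subset_closure hy⟩
  have hslice : ∀ s ∈ J, fderiv ℝ (fun z => H (s, z)) y
      = D (s, y) ∘L ContinuousLinearMap.inr ℝ ℝ 𝔼 := fun s hs =>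
    (hasFDerivAt_slice hO hs hy (hdH hs hy)).fderiv
  have h1 := hasDerivWithinAt_slice hy hdD
  have h2 : HasDerivWithinAt (fun s => D (s, y) ∘L ContinuousLinearMap.inr ℝ ℝ 𝔼)
      ((fderivWithin ℝ D (J ×ˢ O) (t, y) (1, 0)) ∘L ContinuousLinearMap.inr ℝ ℝ 𝔼) J t := by
    have := h1.clm_comp (hasDerivWithinAt_const t J (ContinuousLinearMap.inr ℝ ℝ 𝔼))
    simpa using this
  refine (h2.congr hslice (hslice t ht)).congr_deriv ?_
  have h3 : ∀ z ∈ O, D (t, z) (1, 0) = V (H (t, z)) := fun z hz =>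
    (hJ t ht).eq_deriv _ (hasDerivWithinAt_slice hz (hdH ht hz)) (hflow z hz)
  have h4 : HasFDerivAt (fun z => D (t, z) (1, 0)) _ y :=
    (hasFDerivAt_slice hO ht hy hdD).clm_apply (hasFDerivAt_const ((1 : ℝ), (0 : 𝔼)) y)
  have h5 : HasFDerivAt (fun z => V (H (t, z)))
      (fderiv ℝ V (H (t, y)) ∘L fderiv ℝ (fun z => H (t, z)) y) y :=
    hV.hasFDerivAt.comp y (hasFDerivAt_slice hO ht hy (hdH ht hy)).differentiableAt.hasFDerivAt
  have h6 : (fun z => D (t, z) (1, 0)) =ᶠ[nhds y] fun z => V (H (t, z)) := by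
    filter_upwards [hO.mem_nhds hy] with z hz using h3 z hz
  rw [← (h4.congr_of_eventuallyEq h6.symm).unique h5]
  ext1 v
  have := hsymm.eq (1, 0) (0, v)
  simpa using this

end Variational

/-! ### The flow on the manifold and its differential -/

section Flow

variable {n : ℕ} {M : Type*} [TopologicalSpace M]
  [ChartedSpace (EuclideanSpace ℝ (Fin n)) M]

local notation "𝔼" => EuclideanSpace ℝ (Fin n)
local notation "φ" => extChartAt (M := M) (𝓡 n)

/-- `η` is the smooth flow of the time-dependent vector field `u` on the time interval `J`. -/
structure IsFlow (J : Set ℝ) (u : ℝ → (x : M) → TangentSpace (𝓡 n) x) (η : ℝ → M → M) :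
    Prop where
  ordConnected : J.OrdConnected
  nontrivial : J.Nontrivial
  contMDiffOn : ContMDiffOn (𝓘(ℝ, ℝ).prod (𝓡 n)) (𝓡 n) ∞ (fun p : ℝ × M => η p.1 p.2) (J ×ˢ univ)
  hasMFDerivWithinAt : ∀ t ∈ J, ∀ x, HasMFDerivWithinAt 𝓘(ℝ, ℝ) (𝓡 n) (fun s => η s x) J t
    ((1 : ℝ →L[ℝ] ℝ).smulRight (u t (η t x)))

variable {J : Set ℝ} {u : ℝ → (x : M) → TangentSpace (𝓡 n) x} {η : ℝ → M → M}

theorem IsFlow.contMDiff (h : IsFlow J u η) {t : ℝ} (ht : t ∈ J) :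
    ContMDiff (𝓡 n) (𝓡 n) ∞ (η t) := by
  rw [← contMDiffOn_univ]
  exact h.contMDiffOn.comp (f := fun x : M => (t, x))
    (contMDiff_const.prodMk contMDiff_id).contMDiffOn fun x _ => ⟨ht, mem_univ x⟩

theorem IsFlow.continuousWithinAt (h : IsFlow J u η) {t : ℝ} (ht : t ∈ J) (x : M) :
    ContinuousWithinAt (fun s => η s x) J t := (h.hasMFDerivWithinAt t ht x).1

theorem IsFlow.eventually_mem_source (h : IsFlow J u η) {t : ℝ} (ht : t ∈ J) {x q : M}
    (hq : η t x ∈ (φ q).source) : ∀ᶠ s in nhdsWithin t J, η s x ∈ (φ q).source :=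
  (h.continuousWithinAt ht x).eventually ((isOpen_chart_source q).mem_nhds hq)

theorem continuousOn_of_continuousOn_charts {F : ℝ × M → ℝ} {G : M → ℝ × 𝔼 → ℝ}
    (hG : ∀ q, ContinuousOn (G q) (J ×ˢ (φ q).target))
    (hF : ∀ q, ∀ t ∈ J, ∀ x ∈ (φ q).source, F (t, x) = G q (t, φ q x)) :
    ContinuousOn F (J ×ˢ univ) := by
  rintro ⟨t, q⟩ ⟨ht, -⟩
  have hq : q ∈ (φ q).source := mem_extChartAt_source q
  have h1 : ContinuousOn (fun z : ℝ × M => G q (z.1, φ q z.2)) (J ×ˢ (φ q).source) :=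
    (hG q).comp (f := fun z : ℝ × M => (z.1, φ q z.2))
      (continuousOn_fst.prodMk ((continuousOn_extChartAt q).comp continuousOn_snd
        fun z hz => hz.2)) fun z hz => ⟨hz.1, (φ q).map_source hz.2⟩
  have h2 : ContinuousOn F (J ×ˢ (φ q).source) := h1.congr fun z hz => hF q z.1 hz.1 z.2 hz.2
  refine (h2 (t, q) ⟨ht, hq⟩).mono_of_mem_nhdsWithin ?_
  have h3 : (univ : Set ℝ) ×ˢ (φ q).source ∈ nhds (t, q) :=
    (isOpen_univ.prod (isOpen_chart_source q)).mem_nhds ⟨mem_univ _, hq⟩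
  filter_upwards [mem_nhdsWithin_of_mem_nhds h3, self_mem_nhdsWithin] with z hz1 hz2
  exact ⟨hz2.1, hz1.2⟩

variable [IsManifold (𝓡 n) ∞ M]

/-- The flow equation in coordinates. -/
theorem IsFlow.hasDerivWithinAt_chart (h : IsFlow J u η) {t : ℝ} (ht : t ∈ J) {x q : M}
    (hq : η t x ∈ (φ q).source) :
    HasDerivWithinAt (fun s => φ q (η s x)) (coordField (u t) q (φ q (η t x))) J t := by
  have h1 : HasMFDerivAt (𝓡 n) (𝓡 n) (φ q) (η t x) (chartDeriv q (η t x)) := by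
    have h0 : MDifferentiableAt (𝓡 n) (𝓡 n) (φ q) (η t x) :=
      mdifferentiableAt_extChartAt (by simpa using hq)
    rw [← mfderiv_chart hq]
    exact h0.hasMFDerivAt
  have h2 := h1.comp_hasMFDerivWithinAt t (h.hasMFDerivWithinAt t ht x)
  let L : ℝ →L[ℝ] 𝔼 :=
    (chartDeriv q (η t x)).comp ((1 : ℝ →L[ℝ] ℝ).smulRight (u t (η t x)))
  have h3 : HasFDerivWithinAt (fun s => φ q (η s x)) L J t :=
    hasMFDerivWithinAt_iff_hasFDerivWithinAt.1 h2
  have h4 := h3.hasDerivWithinAt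
  refine h4.congr_deriv ?_
  rw [coordField_chart _ hq]
  change chartDeriv q (η t x) ((1 : ℝ) • u t (η t x)) = _
  rw [one_smul]

/-- The differential of the flow, read in the chart at the image point, solves the linearized
equation. -/
theorem IsFlow.hasDerivWithinAt_mfderiv (h : IsFlow J u η) {t : ℝ} (ht : t ∈ J)
    (hu : IsSmoothField (u t)) {x q : M}
    (hq : η t x ∈ (φ q).source) :
    HasDerivWithinAt
      (fun s => (chartDeriv q (η s x) ∘L mfderiv (𝓡 n) (𝓡 n) (η s) x : 𝔼 →L[ℝ] 𝔼))
      (fderiv ℝ (coordField (u t) q) (φ q (η t x))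
        ∘L (chartDeriv q (η t x) ∘L mfderiv (𝓡 n) (𝓡 n) (η t) x : 𝔼 →L[ℝ] 𝔼)) J t := by
  have hx : x ∈ (φ x).source := mem_extChartAt_source x
  have hxT : φ x x ∈ (φ x).target := mem_extChartAt_target x
  have hcont : ContinuousOn (fun z : ℝ × 𝔼 => η z.1 ((φ x).symm z.2)) (J ×ˢ (φ x).target) :=
    h.contMDiffOn.continuousOn.comp (f := fun z : ℝ × 𝔼 => (z.1, (φ x).symm z.2))
      (continuousOn_fst.prodMk ((continuousOn_extChartAt_symm x).comp continuousOn_snd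
        fun z hz => hz.2)) fun z hz => ⟨hz.1, mem_univ _⟩
  -- Continuity supplies a product neighbourhood of (t, φ x x), relative to J, on which the flow
  -- stays in the chart at q; the coordinate result applies there.
  obtain ⟨W, hW, hWeq⟩ := (continuousOn_iff'.1 hcont) (φ q).source (isOpen_chart_source q)
  have hmem : (t, φ x x) ∈ W := by
    have : (t, φ x x) ∈ (fun z : ℝ × 𝔼 => η z.1 ((φ x).symm z.2)) ⁻¹' (φ q).source
        ∩ J ×ˢ (φ x).target := by
      refine ⟨?_, ht, hxT⟩
      rw [mem_preimage, (φ x).left_inv hx]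
      exact hq
    rw [hWeq] at this
    exact this.1
  obtain ⟨I, O₁, hI, hO₁, htI, hxO, hsub⟩ := isOpen_prod_iff.1 hW _ _ hmem
  set O := O₁ ∩ (φ x).target with hOdef
  have hO : IsOpen O := hO₁.inter (isOpen_chart_target x)
  have hyO : φ x x ∈ O := ⟨hxO, hxT⟩
  have hsrc : ∀ z ∈ (J ∩ I) ×ˢ O, η z.1 ((φ x).symm z.2) ∈ (φ q).source := by
    rintro ⟨s, y⟩ ⟨⟨hs, hsI⟩, hy, hyT⟩
    have : (s, y) ∈ W ∩ J ×ˢ (φ x).target := ⟨hsub ⟨hsI, hy⟩, hs, hyT⟩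
    rw [← hWeq] at this
    exact this.1
  let H : ℝ × 𝔼 → 𝔼 := fun z => φ q (η z.1 ((φ x).symm z.2))
  have hH : ContDiffOn ℝ ∞ H ((J ∩ I) ×ˢ O) := by
    rw [← contMDiffOn_iff_contDiffOn]
    have h1 : ContMDiffOn (𝓡 n) (𝓡 n) ∞ (φ q) (φ q).source := by
      simpa using contMDiffOn_extChartAt (I := 𝓡 n) (n := ∞) (x := q)
    have h2 : ContMDiffOn 𝓘(ℝ, ℝ × 𝔼) (𝓘(ℝ, ℝ).prod (𝓡 n)) ∞
        (fun z : ℝ × 𝔼 => (z.1, (φ x).symm z.2)) ((J ∩ I) ×ˢ O) := by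
      refine ContMDiffOn.prodMk (contDiff_fst.contMDiff.contMDiffOn) ?_
      exact (contMDiffOn_extChartAt_symm x).comp contDiff_snd.contMDiff.contMDiffOn
        fun z hz => hz.2.2
    exact h1.comp (h.contMDiffOn.comp h2 fun z hz => ⟨hz.1.1, mem_univ _⟩) hsrc
  have hJ' : UniqueDiffOn ℝ (J ∩ I) :=
    (uniqueDiffOn_of_ordConnected h.ordConnected h.nontrivial).inter hI
  have htc : t ∈ closure (interior (J ∩ I)) := by
    rw [interior_inter, hI.interior_eq]
    rw [inter_comm]
    exact hI.inter_closure
      ⟨htI, subset_closure_interior_of_ordConnected h.ordConnected h.nontrivial ht⟩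
  have hflow : ∀ z ∈ O, HasDerivWithinAt (fun s => H (s, z))
      (coordField (u t) q (H (t, z))) (J ∩ I) t := fun z hz =>
    (h.hasDerivWithinAt_chart ht (hsrc (t, z) ⟨⟨ht, htI⟩, hz⟩)).mono inter_subset_left
  have hHt : H (t, φ x x) = φ q (η t x) := by
    simp only [H, (φ x).left_inv hx]
  have hmain := hasDerivWithinAt_fderiv_flow hJ' ⟨ht, htI⟩ htc hO hyO hH
    (V := coordField (u t) q) (by rw [hHt]; exact hu.differentiableAt ((φ q).map_source hq)) hflow
  have hchart : ∀ s ∈ J ∩ I, fderiv ℝ (fun z => H (s, z)) (φ x x)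
      = ((chartDeriv q (η s x) ∘L mfderiv (𝓡 n) (𝓡 n) (η s) x : 𝔼 →L[ℝ] 𝔼)
        ∘L (chartFrame x x : 𝔼 →L[ℝ] 𝔼)) := by
    intro s hs
    have hsx : η s x ∈ (φ q).source := by
      have := hsrc (s, φ x x) ⟨hs, hyO⟩
      rwa [(φ x).left_inv hx] at this
    have h1 : MDifferentiableAt (𝓡 n) (𝓡 n) (φ q) (η s x) :=
      mdifferentiableAt_extChartAt (by simpa using hsx)
    have h2 : MDifferentiableAt (𝓡 n) (𝓡 n) (η s) x :=
      (h.contMDiff hs.1).mdifferentiableAt (by simp)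
    have h3 := mfderiv_comp x h1 h2
    rw [mfderiv_chart hsx] at h3
    ext1 v
    exact (fderiv_comp_chart_symm hx (h1.comp x h2) v).trans
      (congrArg (fun L : 𝔼 →L[ℝ] 𝔼 => L (chartFrame x x v)) h3)
  let C : 𝔼 →L[ℝ] 𝔼 := chartDeriv x x
  have hcomp := hmain.clm_comp (hasDerivWithinAt_const t (J ∩ I) C)
  have hA : ∀ s ∈ J ∩ I, (chartDeriv q (η s x) ∘L mfderiv (𝓡 n) (𝓡 n) (η s) x : 𝔼 →L[ℝ] 𝔼)
      = fderiv ℝ (fun z => H (s, z)) (φ x x) ∘L C := by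
    intro s hs
    rw [hchart s hs]
    ext1 v
    exact congrArg (chartDeriv q (η s x) ∘L mfderiv (𝓡 n) (𝓡 n) (η s) x : 𝔼 →L[ℝ] 𝔼)
      (chartFrame_chartDeriv hx v).symm
  rw [← hasDerivWithinAt_inter (hI.mem_nhds htI)]
  refine (hcomp.congr hA (hA t ⟨ht, htI⟩)).congr_deriv ?_
  rw [hA t ⟨ht, htI⟩, hHt]
  ext1 v
  simp

end Flow

/-! ### Liouville's formula, transport of the divergence, conservation of energy -/

section Evolution

variable {n : ℕ} {M : Type*} [TopologicalSpace M]
  [ChartedSpace (EuclideanSpace ℝ (Fin n)) M] [IsManifold (𝓡 n) ∞ M]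

local notation "𝔼" => EuclideanSpace ℝ (Fin n)
local notation "φ" => extChartAt (M := M) (𝓡 n)

variable {J : Set ℝ} {u : ℝ → (x : M) → TangentSpace (𝓡 n) x} {η : ℝ → M → M}

theorem isSmoothField_slice
    (hu : ContMDiffOn (𝓘(ℝ, ℝ).prod (𝓡 n)) (𝓡 n).tangent ∞
      (fun p : ℝ × M => (⟨p.2, u p.1 p.2⟩ : TangentBundle (𝓡 n) M)) (J ×ˢ univ))
    {t : ℝ} (ht : t ∈ J) : IsSmoothField (u t) := fun p =>
  (contDiffOn_coordField hu p).comp (f := fun y : 𝔼 => (t, y))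
    (contDiff_const.prodMk contDiff_id).contDiffOn fun _ hy => ⟨ht, hy⟩

/-- The volume of the image of the standard basis of the tangent space at `x` under the
differential of `f`. -/
def imageVolume (g : RiemMetric n M) (f : M → M) (x : M) : ℝ :=
  boxVolume g (f x) fun i => mfderiv (𝓡 n) (𝓡 n) f x
    (show TangentSpace (𝓡 n) x from EuclideanSpace.single i (1 : ℝ))

theorem imageVolume_eq (g : RiemMetric n M) {f : M → M} {x q : M} (hq : f x ∈ (φ q).source) :
    imageVolume g f x = |(chartDeriv q (f x) ∘L mfderiv (𝓡 n) (𝓡 n) f x : 𝔼 →L[ℝ] 𝔼).det|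
      * chartDensity g q (φ q (f x)) :=
  boxVolume_comp g hq (mfderiv (𝓡 n) (𝓡 n) f x)

/-- Liouville's formula: the volume carried by the flow grows at the rate given by the
divergence. -/
theorem IsFlow.hasDerivWithinAt_imageVolume (h : IsFlow J u η) (g : RiemMetric n M) {t : ℝ}
    (ht : t ∈ J) (hu : IsSmoothField (u t)) (x : M) :
    HasDerivWithinAt (fun s => imageVolume g (η s) x)
      (divergence g (u t) (η t x) * imageVolume g (η t) x) J t := by
  set q := η t x with hqdef
  have hq : η t x ∈ (φ q).source := mem_extChartAt_source _
  have hT : φ q (η t x) ∈ (φ q).target := (φ q).map_source hq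
  have h1 := hasDerivWithinAt_abs_det (h.hasDerivWithinAt_mfderiv ht hu hq)
  have hd := differentiableAt_chartDensity g hT
  have h2 : HasDerivWithinAt (fun s => chartDensity g q (φ q (η s x)))
      (fderiv ℝ (chartDensity g q) (φ q (η t x)) (coordField (u t) q (φ q (η t x)))) J t :=
    HasFDerivAt.comp_hasDerivWithinAt (l := chartDensity g q) (f := fun s => φ q (η s x)) t
      hd.hasFDerivAt (h.hasDerivWithinAt_chart ht hq)
  have hev : (fun s => imageVolume g (η s) x) =ᶠ[nhdsWithin t J] fun s =>
      |(chartDeriv q (η s x) ∘L mfderiv (𝓡 n) (𝓡 n) (η s) x : 𝔼 →L[ℝ] 𝔼).det|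
        * chartDensity g q (φ q (η s x)) := by
    filter_upwards [h.eventually_mem_source ht hq] with s hs
    exact imageVolume_eq g hs
  refine ((h1.mul h2).congr_of_eventuallyEq hev (imageVolume_eq g hq)).congr_deriv ?_
  -- The two terms of the product rule, the trace from the determinant and the derivative of the
  -- density, are the two terms of `weightedDiv_eq`.
  rw [imageVolume_eq g hq, divergence_eq_weightedDiv g hu hq,
    weightedDiv_eq hd (hu.differentiableAt hT) (chartDensity_pos g hT).ne']
  have := (chartDensity_pos g hT).ne'
  field_simp

theorem IsFlow.continuousOn_volumeForm (h : IsFlow J u η) {g : RiemMetric n M}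
    {Ω : (x : M) → (TangentSpace (𝓡 n) x) [⋀^Fin n]→ₗ[ℝ] ℝ} (hΩ : IsVolumeForm g Ω)
    (hu : ∀ t ∈ J, IsSmoothField (u t)) (x : M) :
    ContinuousOn (fun s => Ω (η s x) fun i => mfderiv (𝓡 n) (𝓡 n) (η s) x
      (show TangentSpace (𝓡 n) x from EuclideanSpace.single i (1 : ℝ))) J := by
  intro t ht
  set q := η t x with hqdef
  have hq : η t x ∈ (φ q).source := mem_extChartAt_source _
  have hT : φ q (η t x) ∈ (φ q).target := (φ q).map_source hq
  have h1 := (hasDerivWithinAt_det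
    (h.hasDerivWithinAt_mfderiv ht (hu t ht) hq)).continuousWithinAt
  have h2 : ContinuousWithinAt (fun s => Ω ((φ q).symm (φ q (η s x))) (coordVec q (φ q (η s x))))
      J t :=
    ((hΩ.continuousOn q).continuousAt ((isOpen_chart_target q).mem_nhds hT)).comp_continuousWithinAt
      (f := fun s => φ q (η s x)) (h.hasDerivWithinAt_chart ht hq).continuousWithinAt
  refine (h1.mul h2).congr_of_eventuallyEq ?_ (alternating_comp Ω hq (mfderiv (𝓡 n) (𝓡 n) (η t) x))
  filter_upwards [h.eventually_mem_source ht hq] with s hs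
  exact alternating_comp Ω hs (mfderiv (𝓡 n) (𝓡 n) (η s) x)

theorem contDiffOn_divergence_chart (hJ : UniqueDiffOn ℝ J)
    (hu : ContMDiffOn (𝓘(ℝ, ℝ).prod (𝓡 n)) (𝓡 n).tangent ∞
      (fun p : ℝ × M => (⟨p.2, u p.1 p.2⟩ : TangentBundle (𝓡 n) M)) (J ×ˢ univ))
    (g : RiemMetric n M) (q : M) :
    ContDiffOn ℝ ∞ (fun z : ℝ × 𝔼 => divergence g (u z.1) ((φ q).symm z.2))
      (J ×ˢ (φ q).target) := by
  refine (contDiffOn_weightedDiv (V := fun t => coordField (u t) q) hJ (isOpen_chart_target q)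
    (contDiffOn_chartDensity g q)
    (fun y hy => (chartDensity_pos g hy).ne') (contDiffOn_coordField hu q)).congr fun z hz => ?_
  rw [divergence_eq_weightedDiv g (isSmoothField_slice hu hz.1) ((φ q).map_target hz.2),
    (φ q).right_inv hz.2]

/-- The derivative of the divergence along the flow. -/
theorem IsFlow.hasDerivWithinAt_divergence (h : IsFlow J u η)
    (hu : ContMDiffOn (𝓘(ℝ, ℝ).prod (𝓡 n)) (𝓡 n).tangent ∞
      (fun p : ℝ × M => (⟨p.2, u p.1 p.2⟩ : TangentBundle (𝓡 n) M)) (J ×ˢ univ))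
    (g : RiemMetric n M) {t : ℝ} (ht : t ∈ J) (x : M) :
    HasDerivWithinAt (fun s => divergence g (u s) (η s x))
      (derivWithin (fun s => divergence g (u s) (η t x)) J t
        + advect (u t) (divergence g (u t)) (η t x)) J t := by
  have hJ := uniqueDiffOn_of_ordConnected h.ordConnected h.nontrivial
  set q := η t x with hqdef
  have hq : η t x ∈ (φ q).source := mem_extChartAt_source _
  set T := (φ q).target with hTdef
  have hT : φ q (η t x) ∈ T := (φ q).map_source hq
  set R : ℝ × 𝔼 → ℝ := fun z => divergence g (u z.1) ((φ q).symm z.2) with hR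
  have hRd : DifferentiableWithinAt ℝ R (J ×ˢ T) (t, φ q (η t x)) :=
    (contDiffOn_divergence_chart hJ hu g q _ ⟨ht, hT⟩).differentiableWithinAt (by simp)
  have hev : ∀ᶠ s in nhdsWithin t J, η s x ∈ (φ q).source := h.eventually_mem_source ht hq
  have h1 : HasDerivWithinAt (fun s => (s, φ q (η s x)))
      ((1 : ℝ), coordField (u t) q (φ q (η t x))) J t :=
    (hasDerivWithinAt_id t J).prodMk (h.hasDerivWithinAt_chart ht hq)
  have hev' : ∀ᶠ s in nhdsWithin t J, (s, φ q (η s x)) ∈ J ×ˢ T := by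
    filter_upwards [hev, self_mem_nhdsWithin] with s hs hsJ
    exact ⟨hsJ, (φ q).map_source hs⟩
  have h2 : HasDerivWithinAt (fun s => R (s, φ q (η s x)))
      (fderivWithin ℝ R (J ×ˢ T) (t, φ q (η t x)) (1, coordField (u t) q (φ q (η t x)))) J t := by
    obtain ⟨I, hI, htI, hIs⟩ := mem_nhdsWithin.1 hev'
    rw [← hasDerivWithinAt_inter (hI.mem_nhds htI)]
    exact HasFDerivWithinAt.comp_hasDerivWithinAt (l := R) (f := fun s => (s, φ q (η s x))) t
      hRd.hasFDerivWithinAt (h1.mono inter_subset_left) fun s hs => hIs ⟨hs.2, hs.1⟩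
  have hev2 : (fun s => divergence g (u s) (η s x)) =ᶠ[nhdsWithin t J]
      fun s => R (s, φ q (η s x)) := by
    filter_upwards [hev] with s hs
    simp only [hR, (φ q).left_inv hs]
  refine (h2.congr_of_eventuallyEq hev2 (by simp only [hR, (φ q).left_inv hq])).congr_deriv ?_
  have h3 : derivWithin (fun s => divergence g (u s) (η t x)) J t
      = fderivWithin ℝ R (J ×ˢ T) (t, φ q (η t x)) (1, 0) := by
    have := (hasDerivWithinAt_slice hT hRd).derivWithin (hJ t ht)
    simpa only [hR, (φ q).left_inv hq] using this
  have h4 : advect (u t) (divergence g (u t)) (η t x)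
      = fderivWithin ℝ R (J ×ˢ T) (t, φ q (η t x)) (0, coordField (u t) q (φ q (η t x))) := by
    rw [advect_eq_fderiv (u t) hq
      ((contMDiff_divergence g (isSmoothField_slice hu ht)).mdifferentiableAt (by simp))]
    have := (hasFDerivAt_slice (isOpen_chart_target q) ht hT hRd).fderiv
    refine (congrArg (fun L : 𝔼 →L[ℝ] ℝ => L (coordField (u t) q (φ q (η t x)))) this).trans ?_
    rw [ContinuousLinearMap.comp_apply, ContinuousLinearMap.inr_apply]
  rw [h3, h4, ← map_add]
  simp

theorem continuousOn_divergence (hJ : UniqueDiffOn ℝ J)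
    (hu : ContMDiffOn (𝓘(ℝ, ℝ).prod (𝓡 n)) (𝓡 n).tangent ∞
      (fun p : ℝ × M => (⟨p.2, u p.1 p.2⟩ : TangentBundle (𝓡 n) M)) (J ×ˢ univ))
    (g : RiemMetric n M) :
    ContinuousOn (fun z : ℝ × M => divergence g (u z.1) z.2) (J ×ˢ univ) :=
  continuousOn_of_continuousOn_charts
    (fun q => (contDiffOn_divergence_chart hJ hu g q).continuousOn) fun q t _ x hx => by
      simp only [(φ q).left_inv hx]

theorem hasDerivWithinAt_divergence_chart (hJ : UniqueDiffOn ℝ J)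
    (hu : ContMDiffOn (𝓘(ℝ, ℝ).prod (𝓡 n)) (𝓡 n).tangent ∞
      (fun p : ℝ × M => (⟨p.2, u p.1 p.2⟩ : TangentBundle (𝓡 n) M)) (J ×ˢ univ))
    (g : RiemMetric n M) {t : ℝ} (ht : t ∈ J) {q x : M} (hx : x ∈ (φ q).source) :
    HasDerivWithinAt (fun s => divergence g (u s) x)
      (fderivWithin ℝ (fun z : ℝ × 𝔼 => divergence g (u z.1) ((φ q).symm z.2))
        (J ×ˢ (φ q).target) (t, φ q x) (1, 0)) J t := by
  have h := hasDerivWithinAt_slice ((φ q).map_source hx)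
    ((contDiffOn_divergence_chart hJ hu g q _
      ⟨ht, (φ q).map_source hx⟩).differentiableWithinAt (by simp))
  simpa only [(φ q).left_inv hx] using h

theorem continuousOn_derivWithin_divergence (hJ : UniqueDiffOn ℝ J)
    (hu : ContMDiffOn (𝓘(ℝ, ℝ).prod (𝓡 n)) (𝓡 n).tangent ∞
      (fun p : ℝ × M => (⟨p.2, u p.1 p.2⟩ : TangentBundle (𝓡 n) M)) (J ×ˢ univ))
    (g : RiemMetric n M) :
    ContinuousOn (fun z : ℝ × M => derivWithin (fun s => divergence g (u s) z.2) J z.1)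
      (J ×ˢ univ) :=
  continuousOn_of_continuousOn_charts
    (fun q => ((contDiffOn_divergence_chart hJ hu g q).continuousOn_fderivWithin
      (hJ.prod (isOpen_chart_target q).uniqueDiffOn) (by simp)).clm_apply continuousOn_const)
    fun _ t ht _ hx => (hasDerivWithinAt_divergence_chart hJ hu g ht hx).derivWithin (hJ t ht)

variable [MeasurableSpace M] [BorelSpace M] [CompactSpace M] [T2Space M]

/-- The equation forces `∫ ρ ρ_t = 0`. -/
theorem integral_divergence_mul_eq_zero (g : RiemMetric n M)
    {v : (x : M) → TangentSpace (𝓡 n) x} (hv : IsSmoothField v) {r : M → ℝ} {C : ℝ}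
    (hr : ∀ x, r x + advect v (divergence g v) x + (1 / 2) * divergence g v x ^ 2 = C) :
    ∫ x, 2 * divergence g v x * r x ∂volumeMeasure g = 0 := by
  set ρ := divergence g v with hρ
  have hρs : ContMDiff (𝓡 n) 𝓘(ℝ, ℝ) ∞ ρ := contMDiff_divergence g hv
  have hv1 : IsSmoothField fun x => ρ x • v x := hv.smul hρs
  have hv2 : IsSmoothField fun x => ρ x • (ρ x • v x) := hv1.smul hρs
  -- This is div(ρ² v) = ρ³ + 2ρ v·∇ρ combined with the equation. The value of C is irrelevant
  -- because ρ itself has integral zero.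
  have h1 : ∀ x, 2 * ρ x * r x
      = 2 * C * ρ x - divergence g (fun x => ρ x • (ρ x • v x)) x := by
    intro x
    have h2 : advect (fun x => ρ x • v x) ρ x = ρ x * advect v ρ x := by
      unfold advect
      rw [map_smul]
      rfl
    rw [divergence_smul g hρs hv1, divergence_smul g hρs hv, h2, ← hρ]
    linear_combination 2 * ρ x * hr x
  rw [integral_congr_ae (Filter.Eventually.of_forall h1), integral_sub, integral_const_mul, hρ,
    integral_divergence_eq_zero g hv, integral_divergence_eq_zero g hv2]
  · simp
  · exact (integrable_of_continuous g hρs.continuous).const_mul _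
  · exact integrable_of_continuous g (contMDiff_divergence g hv2).continuous

/-- The energy `∫ ρ²` is conserved. -/
theorem integral_divergence_sq_eq (hJo : J.OrdConnected) (hJn : J.Nontrivial)
    (hu : ContMDiffOn (𝓘(ℝ, ℝ).prod (𝓡 n)) (𝓡 n).tangent ∞
      (fun p : ℝ × M => (⟨p.2, u p.1 p.2⟩ : TangentBundle (𝓡 n) M)) (J ×ˢ univ))
    (g : RiemMetric n M) {C : ℝ → ℝ}
    (hpde : ∀ t ∈ J, ∀ x, derivWithin (fun s => divergence g (u s) x) J t
      + advect (u t) (divergence g (u t)) x + (1 / 2) * divergence g (u t) x ^ 2 = C t)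
    {a b : ℝ} (ha : a ∈ J) (hb : b ∈ J) (hab : a ≤ b) :
    ∫ x, divergence g (u b) x ^ 2 ∂volumeMeasure g
      = ∫ x, divergence g (u a) x ^ 2 ∂volumeMeasure g := by
  have := ChartedSpace.secondCountable_of_sigmaCompact 𝔼 M
  have hJ := uniqueDiffOn_of_ordConnected hJo hJn
  have hIcc : Icc a b ⊆ J := hJo.out ha hb
  set G : ℝ → M → ℝ := fun t x =>
    2 * divergence g (u t) x * derivWithin (fun s => divergence g (u s) x) J t with hG
  have hGc : ContinuousOn (fun z : ℝ × M => G z.1 z.2) (J ×ˢ univ) :=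
    (continuousOn_const.mul (continuousOn_divergence hJ hu g)).mul
      (continuousOn_derivWithin_divergence hJ hu g)
  have hderiv : ∀ x, ∀ t ∈ J, HasDerivWithinAt (fun s => divergence g (u s) x ^ 2) (G t x) J t := by
    intro x t ht
    have h1 := hasDerivWithinAt_divergence_chart hJ hu g ht (mem_extChartAt_source (I := 𝓡 n) x)
    have h2 := h1.differentiableWithinAt.hasDerivWithinAt.pow 2
    refine h2.congr_deriv ?_
    simp [hG]
  have hGx : ∀ x, ContinuousOn (fun t => G t x) (Icc a b) := fun x =>
    hGc.comp (f := fun t : ℝ => (t, x)) (continuousOn_id.prodMk continuousOn_const)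
      fun t ht => ⟨hIcc ht, mem_univ _⟩
  -- The fundamental theorem of calculus at each point, followed by Fubini, replaces differentiation
  -- under the integral over M.
  have hFTC : ∀ x, ∫ t in Icc a b, G t x
      = divergence g (u b) x ^ 2 - divergence g (u a) x ^ 2 := by
    intro x
    rw [integral_Icc_eq_integral_Ioc, ← intervalIntegral.integral_of_le hab]
    refine intervalIntegral.integral_eq_sub_of_hasDerivAt_of_le hab
      (f := fun s => divergence g (u s) x ^ 2)
      (fun t ht => ((hderiv x t (hIcc ht)).mono hIcc).continuousWithinAt) (fun t ht => ?_)
      ((hGx x).intervalIntegrable_of_Icc hab)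
    exact (hderiv x t (hIcc (Ioo_subset_Icc_self ht))).hasDerivAt
      (Filter.mem_of_superset (Icc_mem_nhds ht.1 ht.2) hIcc)
  have hint : Integrable (Function.uncurry G)
      (((volume : Measure ℝ).restrict (Icc a b)).prod (volumeMeasure g)) := by
    have h1 : IntegrableOn (Function.uncurry G) (Icc a b ×ˢ univ)
        ((volume : Measure ℝ).prod (volumeMeasure g)) :=
      (hGc.mono (prod_mono_left hIcc)).integrableOn_compact (isCompact_Icc.prod isCompact_univ)
    rw [IntegrableOn, ← Measure.prod_restrict, Measure.restrict_univ] at h1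
    exact h1
  have hzero : ∀ t ∈ Icc a b, ∫ x, G t x ∂volumeMeasure g = 0 := fun t ht =>
    integral_divergence_mul_eq_zero g (isSmoothField_slice hu (hIcc ht)) (hpde t (hIcc ht))
  have hswap := integral_integral_swap hint
  rw [setIntegral_congr_fun measurableSet_Icc hzero] at hswap
  simp only [hFTC, integral_zero] at hswap
  have hi : ∀ t ∈ J, Integrable (fun x => divergence g (u t) x ^ 2) (volumeMeasure g) :=
    fun t ht => integrable_of_continuous g
      ((contMDiff_divergence g (isSmoothField_slice hu ht)).continuous.pow 2)
  rw [integral_sub (hi b hb) (hi a ha)] at hswap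
  linarith

end Evolution

/-! ### The Riccati equation and the linear equation for the volume -/

section ScalarEquations

variable {J : Set ℝ}

theorem eq_of_hasDerivWithinAt_zero (hJ : J.OrdConnected) (hJn : J.Nontrivial) {f : ℝ → ℝ}
    (hf : ∀ t ∈ J, HasDerivWithinAt f 0 J t) {s t : ℝ} (hs : s ∈ J) (ht : t ∈ J) : f s = f t := by
  refine (Set.OrdConnected.convex (𝕜 := ℝ) hJ).is_const_of_fderivWithin_eq_zero (𝕜 := ℝ)
    (fun t ht => (hf t ht).differentiableWithinAt) (fun t ht => ?_) hs ht
  have := (hf t ht).hasFDerivWithinAt.fderivWithin (uniqueDiffOn_of_ordConnected hJ hJn t ht)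
  rw [this]
  ext
  simp

/-- The solution of `r' = -r² / 2 - 2 κ²`. -/
theorem arctan_of_riccati (hJ : J.OrdConnected) (hJn : J.Nontrivial) (h0 : (0 : ℝ) ∈ J)
    {r : ℝ → ℝ} {κ : ℝ} (hκ : κ ≠ 0)
    (hr : ∀ t ∈ J, HasDerivWithinAt r (-(2 * κ ^ 2) - (1 / 2) * r t ^ 2) J t) {t : ℝ}
    (ht : t ∈ J) :
    Real.arctan (r t / (2 * κ)) = Real.arctan (r 0 / (2 * κ)) - κ * t := by
  -- Since r' = -2κ²(1 + (r/2κ)²), the derivative of arctan(r/2κ) is -κ.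
  have h := eq_of_hasDerivWithinAt_zero hJ hJn
    (f := fun s => Real.arctan (r s / (2 * κ)) + κ * s) (fun s hs => ?_) ht h0
  · simp only [mul_zero, add_zero] at h
    linarith
  · have h1 := ((hr s hs).div_const (2 * κ)).arctan.add ((hasDerivWithinAt_id s J).const_mul κ)
    refine h1.congr_deriv ?_
    have : 1 + (r s / (2 * κ)) ^ 2 ≠ 0 := by positivity
    field_simp
    ring

/-- Since cos(arctan b) > 0, this turns the bound on the angle into positivity of cos s + b sin s,
the square root of the Jacobian. -/
theorem cos_arctan_sub (b s : ℝ) :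
    Real.cos (Real.arctan b - s)
      = Real.cos (Real.arctan b) * (Real.cos s + b * Real.sin s) := by
  have h1 : Real.sin (Real.arctan b) = b * Real.cos (Real.arctan b) := by
    conv_rhs => rw [← Real.tan_arctan b]
    rw [Real.arctan_tan (Real.neg_pi_div_two_lt_arctan b) (Real.arctan_lt_pi_div_two b)]
    exact (Real.tan_mul_cos (Real.cos_arctan_pos b).ne').symm
  rw [Real.cos_sub, h1]
  ring

theorem cos_add_mul_sin_pos {b s : ℝ}
    (h : Real.arctan b - s ∈ Ioo (-(Real.pi / 2)) (Real.pi / 2)) :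
    0 < Real.cos s + b * Real.sin s := by
  have h1 := Real.cos_pos_of_mem_Ioo h
  rw [cos_arctan_sub] at h1
  exact pos_of_mul_pos_right h1 (Real.cos_arctan_pos b).le

/-- The solution of `m' = r m` for `r = 2 κ tan (arctan b - κ t)`. -/
theorem volume_of_riccati (hJ : J.OrdConnected) (hJn : J.Nontrivial) (h0 : (0 : ℝ) ∈ J)
    {r m : ℝ → ℝ} {κ b : ℝ}
    (hmem : ∀ t ∈ J, Real.arctan b - κ * t ∈ Ioo (-(Real.pi / 2)) (Real.pi / 2))
    (hr : ∀ t ∈ J, r t = 2 * κ * Real.tan (Real.arctan b - κ * t))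
    (hm : ∀ t ∈ J, HasDerivWithinAt m (r t * m t) J t) {t : ℝ} (ht : t ∈ J) :
    m t = (Real.cos (κ * t) + b * Real.sin (κ * t)) ^ 2 * m 0 := by
  -- The derivative of cos²(arctan b - κs) is 2κ tan(arctan b - κs) times itself, so it solves the
  -- same linear equation as m and the quotient is constant.
  have h := eq_of_hasDerivWithinAt_zero hJ hJn
    (f := fun s => m s / Real.cos (Real.arctan b - κ * s) ^ 2) (fun s hs => ?_) ht h0
  · have h1 := (Real.cos_pos_of_mem_Ioo (hmem t ht)).ne'
    have h2 := (Real.cos_arctan_pos b).ne'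
    simp only [mul_zero, sub_zero] at h
    rw [div_eq_div_iff (by positivity) (by positivity), cos_arctan_sub] at h
    have h3 : Real.cos (Real.arctan b) ^ 2 ≠ 0 := by positivity
    apply mul_right_cancel₀ h3
    rw [h]
    ring
  · have h1 := (Real.cos_pos_of_mem_Ioo (hmem s hs)).ne'
    have h2 : HasDerivWithinAt (fun s => Real.arctan b - κ * s) (-κ) J s := by
      simpa using ((hasDerivWithinAt_id s J).const_mul κ).const_sub (Real.arctan b)
    refine ((hm s hs).div (h2.cos.pow 2) (pow_ne_zero 2 h1)).congr_deriv ?_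
    rw [hr s hs, Real.tan_eq_sin_div_cos]
    simp only [Pi.pow_apply]
    field_simp
    push_cast
    ring

end ScalarEquations

/-! ### The solution along the flow and the pullback of volume forms -/

section Solutions

variable {n : ℕ} {M : Type*} [TopologicalSpace M]
  [ChartedSpace (EuclideanSpace ℝ (Fin n)) M] [IsManifold (𝓡 n) ∞ M]

theorem imageVolume_id_pos (g : RiemMetric n M) (x : M) : 0 < imageVolume g id x := by
  have hx : id x ∈ (extChartAt (𝓡 n) x).source := mem_extChartAt_source x
  have h : (chartDeriv x (id x) ∘L mfderiv (𝓡 n) (𝓡 n) id x :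
      EuclideanSpace ℝ (Fin n) →L[ℝ] EuclideanSpace ℝ (Fin n)) = ContinuousLinearMap.id ℝ _ := by
    rw [← mfderiv_chart hx, mfderiv_id]
    exact (ContinuousLinearMap.comp_id _).trans mfderiv_extChartAt_self
  have h1 : (ContinuousLinearMap.id ℝ (EuclideanSpace ℝ (Fin n))).det = 1 := LinearMap.det_id
  rw [imageVolume_eq g hx, h, h1, abs_one, one_mul]
  exact chartDensity_pos g ((extChartAt (𝓡 n) x).map_source hx)

theorem jacobian_eq_div (g : RiemMetric n M) (f : M → M) (x : M) :
    jacobian g f x = imageVolume g f x / imageVolume g id x := by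
  unfold jacobian
  congr 1
  unfold imageVolume
  rw [mfderiv_id]
  rfl

variable {J : Set ℝ} {u : ℝ → (x : M) → TangentSpace (𝓡 n) x} {η : ℝ → M → M}

/-- Two `n`-forms that agree on the standard basis agree. -/
theorem alternating_ext {x : M} {Ω₁ Ω₂ : (TangentSpace (𝓡 n) x) [⋀^Fin n]→ₗ[ℝ] ℝ}
    (h : (Ω₁ fun i => (show TangentSpace (𝓡 n) x from EuclideanSpace.single i (1 : ℝ)))
      = Ω₂ fun i => (show TangentSpace (𝓡 n) x from EuclideanSpace.single i (1 : ℝ))) :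
    Ω₁ = Ω₂ := by
  let b : Module.Basis (Fin n) ℝ (TangentSpace (𝓡 n) x) :=
    (EuclideanSpace.basisFun (Fin n) ℝ).toBasis
  have hb : (b : Fin n → TangentSpace (𝓡 n) x)
      = fun i => (show TangentSpace (𝓡 n) x from EuclideanSpace.single i (1 : ℝ)) := by
    funext i
    exact (congrFun (EuclideanSpace.basisFun (Fin n) ℝ).coe_toBasis i).trans
      (EuclideanSpace.basisFun_apply _ _ i)
  rw [Ω₁.eq_smul_basis_det b, Ω₂.eq_smul_basis_det b, hb, h]

/-- The pullback of a volume form under the flow. -/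
theorem IsFlow.pullback_volumeForm (h : IsFlow J u η) (h0 : (0 : ℝ) ∈ J) (hη0 : η 0 = id)
    (hu : ∀ t ∈ J, IsSmoothField (u t)) {g : RiemMetric n M}
    {Ω : (x : M) → (TangentSpace (𝓡 n) x) [⋀^Fin n]→ₗ[ℝ] ℝ} (hΩ : IsVolumeForm g Ω)
    {x : M} {c : ℝ → ℝ} (hc : ContinuousOn c J) (hcpos : ∀ t ∈ J, 0 < c t) (hc0 : c 0 = 1)
    (hvol : ∀ t ∈ J, imageVolume g (η t) x = c t * imageVolume g id x) {t : ℝ} (ht : t ∈ J) :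
    (Ω (η t x)).compLinearMap (mfderiv (𝓡 n) (𝓡 n) (η t) x).toLinearMap = c t • Ω x := by
  apply alternating_ext
  set e : Fin n → TangentSpace (𝓡 n) x := fun i =>
    (show TangentSpace (𝓡 n) x from EuclideanSpace.single i (1 : ℝ)) with he
  set F : ℝ → ℝ := fun s => Ω (η s x) fun i => mfderiv (𝓡 n) (𝓡 n) (η s) x (e i) with hF
  have habs : ∀ s, |F s| = imageVolume g (η s) x := fun s => hΩ.abs_eq _ _
  have hF0 : F 0 = Ω x e := by
    simp only [hF]
    rw [hη0, mfderiv_id]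
    rfl
  have habs0 : |Ω x e| = imageVolume g id x := by
    rw [← hF0, habs, hη0]
  have hne : Ω x e ≠ 0 := abs_pos.1 (habs0 ▸ imageVolume_id_pos g x)
  -- The volume identity determines F only up to sign. Two continuous functions on the interval J
  -- with equal squares, the second without zeros, agree if they agree at time 0.
  have key := h.ordConnected.isPreconnected.eq_of_sq_eq (f := F) (g := fun s => c s * Ω x e)
    (h.continuousOn_volumeForm hΩ hu x) (hc.mul continuousOn_const) ?_ ?_ h0 ?_
  · exact key ht
  · intro s hs
    simp only [Pi.pow_apply]
    rw [← sq_abs, habs, hvol s hs, mul_pow, mul_pow, ← habs0, sq_abs]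
  · exact fun hs => mul_ne_zero (hcpos _ hs).ne' hne
  · simp only [hF0, hc0, one_mul]

variable [MeasurableSpace M] [BorelSpace M] [CompactSpace M]

theorem eq_zero_of_integral_sq_eq_zero (g : RiemMetric n M) {f : M → ℝ} (hf : Continuous f)
    (h : ∫ x, f x ^ 2 ∂volumeMeasure g = 0) (x : M) : f x = 0 := by
  rw [integral_eq_zero_iff_of_nonneg (fun x => sq_nonneg (f x))
    (integrable_of_continuous g (hf.pow 2))] at h
  have h1 := (Continuous.ae_eq_iff_eq (volumeMeasure g) (hf.pow 2) continuous_zero).1 h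
  exact pow_eq_zero_iff (two_ne_zero) |>.1 (congrFun h1 x)

/-- The solution of the equation along the flow. -/
theorem IsFlow.divergence_solution [T2Space M] (h : IsFlow J u η) (h0 : (0 : ℝ) ∈ J) (hη0 : η 0 = id)
    (hu : ContMDiffOn (𝓘(ℝ, ℝ).prod (𝓡 n)) (𝓡 n).tangent ∞
      (fun p : ℝ × M => (⟨p.2, u p.1 p.2⟩ : TangentBundle (𝓡 n) M)) (J ×ˢ univ))
    (g : RiemMetric n M)
    (hpde : ∀ t ∈ J, ∀ x, derivWithin (fun s => divergence g (u s) x) J t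
      + advect (u t) (divergence g (u t)) x + (1 / 2) * divergence g (u t) x ^ 2
      = -(∫ y, divergence g (u t) y ^ 2 ∂volumeMeasure g) / (2 * (volumeMeasure g).real univ))
    {κ : ℝ} (hκ : κ ^ 2 = 1 / (4 * (volumeMeasure g).real univ)
      * ∫ x, divergence g (u 0) x ^ 2 ∂volumeMeasure g) {t : ℝ} (ht : t ∈ J) (x : M) :
    Real.arctan (divergence g (u 0) x / (2 * κ)) - κ * t ∈ Ioo (-(Real.pi / 2)) (Real.pi / 2) ∧
      divergence g (u t) (η t x)
        = 2 * κ * Real.tan (Real.arctan (divergence g (u 0) x / (2 * κ)) - κ * t) := by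
  have hE : ∀ t ∈ J, ∫ y, divergence g (u t) y ^ 2 ∂volumeMeasure g
      = ∫ y, divergence g (u 0) y ^ 2 ∂volumeMeasure g := by
    intro t ht
    rcases le_total 0 t with h1 | h1
    · exact integral_divergence_sq_eq h.ordConnected h.nontrivial hu g hpde h0 ht h1
    · exact (integral_divergence_sq_eq h.ordConnected h.nontrivial hu g hpde ht h0 h1).symm
  have hV : 0 < (volumeMeasure g).real univ := by
    have : Nonempty M := ⟨x⟩
    exact ENNReal.toReal_pos (isOpen_univ.measure_pos _ univ_nonempty).ne' (measure_ne_top _ _)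
  have hE0 : ∫ y, divergence g (u 0) y ^ 2 ∂volumeMeasure g
      = 4 * κ ^ 2 * (volumeMeasure g).real univ := by
    rw [hκ]
    field_simp
  by_cases hκ0 : κ = 0
  -- The conserved energy is zero, so ρ vanishes identically; division by 2 * 0 gives 0, and the
  -- angle is arctan 0 = 0.
  · subst hκ0
    have hz : divergence g (u t) (η t x) = 0 :=
      eq_zero_of_integral_sq_eq_zero g
        (contMDiff_divergence g (isSmoothField_slice hu ht)).continuous
        (by rw [hE t ht, hE0]; ring) _
    rw [hz]
    simp [Real.pi_pos]
  · have hr : ∀ s ∈ J, HasDerivWithinAt (fun s => divergence g (u s) (η s x))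
        (-(2 * κ ^ 2) - (1 / 2) * divergence g (u s) (η s x) ^ 2) J s := by
      intro s hs
      refine (h.hasDerivWithinAt_divergence hu g hs x).congr_deriv ?_
      have h1 := hpde s hs (η s x)
      rw [hE s hs, hE0] at h1
      have h2 : -(4 * κ ^ 2 * (volumeMeasure g).real univ) / (2 * (volumeMeasure g).real univ)
          = -(2 * κ ^ 2) := by
        field_simp
        ring
      rw [h2] at h1
      linarith
    have h1 := arctan_of_riccati h.ordConnected h.nontrivial h0 hκ0 hr ht
    have h2 : divergence g (u 0) (η 0 x) = divergence g (u 0) x := by rw [hη0]; rfl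
    simp only [h2] at h1
    rw [← h1, Real.tan_arctan]
    refine ⟨⟨Real.neg_pi_div_two_lt_arctan _, Real.arctan_lt_pi_div_two _⟩, ?_⟩
    field_simp

end Solutions

end HunterSaxton

end

/-! ### The main theorem -/

theorem mainTheorem3 {n : ℕ} {M : Type*} [TopologicalSpace M] [T2Space M] [CompactSpace M]
    [ChartedSpace (EuclideanSpace ℝ (Fin n)) M] [IsManifold (𝓡 n) ∞ M]
    [MeasurableSpace M] [BorelSpace M]
    (g : HunterSaxton.RiemMetric n M)
    -- the time interval of existence
    (J : Set ℝ) (hJ : J.OrdConnected) (hJ_nontrivial : J.Nontrivial) (hJ_zero : (0 : ℝ) ∈ J)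
    -- the initial field, and the smooth solution with its velocity field
    (u₀ : (x : M) → TangentSpace (𝓡 n) x)
    (hu₀ : ContMDiff (𝓡 n) (𝓡 n).tangent ∞ (fun x => (⟨x, u₀ x⟩ : TangentBundle (𝓡 n) M)))
    (u : ℝ → (x : M) → TangentSpace (𝓡 n) x)
    (hu : ContMDiffOn (𝓘(ℝ, ℝ).prod (𝓡 n)) (𝓡 n).tangent ∞
      (fun p : ℝ × M => (⟨p.2, u p.1 p.2⟩ : TangentBundle (𝓡 n) M)) (J ×ˢ univ))
    (ρ : ℝ → M → ℝ)
    (hρ : ∀ t ∈ J, ∀ x, ρ t x = HunterSaxton.divergence g (u t) x)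
    (hpde : ∀ t ∈ J, ∀ x,
      derivWithin (fun s => ρ s x) J t + HunterSaxton.advect (u t) (ρ t) x
          + (1 / 2) * ρ t x ^ 2
        = -(∫ y, ρ t y ^ 2 ∂HunterSaxton.volumeMeasure g)
            / (2 * (HunterSaxton.volumeMeasure g).real univ))
    (hinit : ∀ x, ρ 0 x = HunterSaxton.divergence g u₀ x)
    -- the flow of the velocity field
    (η : ℝ → M → M)
    (hη : ContMDiffOn (𝓘(ℝ, ℝ).prod (𝓡 n)) (𝓡 n) ∞ (fun p : ℝ × M => η p.1 p.2) (J ×ˢ univ))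
    (hη_flow : ∀ t ∈ J, ∀ x, HasMFDerivWithinAt 𝓘(ℝ, ℝ) (𝓡 n) (fun s => η s x) J t
      ((1 : ℝ →L[ℝ] ℝ).smulRight (u t (η t x))))
    (hη_zero : ∀ x, η 0 x = x)
    (κ : ℝ)
    (hκ : κ ^ 2 = 1 / (4 * (HunterSaxton.volumeMeasure g).real univ)
      * ∫ x, HunterSaxton.divergence g u₀ x ^ 2 ∂HunterSaxton.volumeMeasure g) :
    -- the solution along the flow (the tangent is taken at a point where it is defined)
    (∀ t ∈ J, ∀ x,
      Real.arctan (HunterSaxton.divergence g u₀ x / (2 * κ)) - κ * t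
          ∈ Ioo (-(Real.pi / 2)) (Real.pi / 2) ∧
      ρ t (η t x) =
        2 * κ * Real.tan (Real.arctan (HunterSaxton.divergence g u₀ x / (2 * κ)) - κ * t)) ∧
    -- the Jacobian of the flow
    (∀ t ∈ J, ∀ x,
      HunterSaxton.jacobian g (η t) x =
        (Real.cos (κ * t)
          + HunterSaxton.divergence g u₀ x / (2 * κ) * Real.sin (κ * t)) ^ 2) ∧
    -- on an oriented manifold this is the Jacobian with respect to the volume form
    (∀ Ω : (x : M) → (TangentSpace (𝓡 n) x) [⋀^Fin n]→ₗ[ℝ] ℝ,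
      HunterSaxton.IsVolumeForm g Ω → ∀ t ∈ J, ∀ x,
        (Ω (η t x)).compLinearMap (mfderiv (𝓡 n) (𝓡 n) (η t) x).toLinearMap =
          (Real.cos (κ * t)
            + HunterSaxton.divergence g u₀ x / (2 * κ) * Real.sin (κ * t)) ^ 2 • Ω x) ∧
    -- the square root of the Jacobian runs along a great circle through the function `1`,
    -- on the sphere of radius `√ μ(M)` of `L²(M, μ)`
    (κ ≠ 0 → ∃ p w : Lp ℝ 2 (HunterSaxton.volumeMeasure g),
      (p =ᵐ[HunterSaxton.volumeMeasure g] fun _ => (1 : ℝ)) ∧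
      (w =ᵐ[HunterSaxton.volumeMeasure g] fun x => HunterSaxton.divergence g u₀ x / (2 * κ)) ∧
      ‖p‖ = Real.sqrt ((HunterSaxton.volumeMeasure g).real univ) ∧
      ‖w‖ = Real.sqrt ((HunterSaxton.volumeMeasure g).real univ) ∧
      inner ℝ p w = 0 ∧
      ∀ t ∈ J, (fun x => Real.sqrt (HunterSaxton.jacobian g (η t) x))
        =ᵐ[HunterSaxton.volumeMeasure g]
          (Real.cos (κ * t) • p + Real.sin (κ * t) • w :
            Lp ℝ 2 (HunterSaxton.volumeMeasure g))) := by
  have hflow : HunterSaxton.IsFlow J u η := ⟨hJ, hJ_nontrivial, hη, hη_flow⟩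
  have hη0 : η 0 = id := funext hη_zero
  have hsm : ∀ t ∈ J, HunterSaxton.IsSmoothField (u t) := fun t ht =>
    HunterSaxton.isSmoothField_slice hu ht
  have hρ' : ∀ t ∈ J, ρ t = HunterSaxton.divergence g (u t) := fun t ht => funext (hρ t ht)
  have hdiv0 : HunterSaxton.divergence g u₀ = HunterSaxton.divergence g (u 0) := by
    rw [← hρ' 0 hJ_zero]
    exact (funext hinit).symm
  have hpde' : ∀ t ∈ J, ∀ x, derivWithin (fun s => HunterSaxton.divergence g (u s) x) J t
      + HunterSaxton.advect (u t) (HunterSaxton.divergence g (u t)) x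
      + (1 / 2) * HunterSaxton.divergence g (u t) x ^ 2
      = -(∫ y, HunterSaxton.divergence g (u t) y ^ 2 ∂HunterSaxton.volumeMeasure g)
        / (2 * (HunterSaxton.volumeMeasure g).real univ) := by
    intro t ht x
    have h := hpde t ht x
    -- The function ρ is the divergence of u only for times in J, which suffices for derivatives
    -- within J.
    rw [derivWithin_congr (fun s hs => hρ s hs x) (hρ t ht x), hρ' t ht] at h
    exact h
  rw [hdiv0] at hκ ⊢
  set b : M → ℝ := fun x => HunterSaxton.divergence g (u 0) x / (2 * κ) with hb
  have hsol := fun t (ht : t ∈ J) x =>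
    hflow.divergence_solution hJ_zero hη0 hu g hpde' hκ ht x
  have hpos : ∀ t ∈ J, ∀ x, 0 < Real.cos (κ * t) + b x * Real.sin (κ * t) := fun t ht x =>
    HunterSaxton.cos_add_mul_sin_pos (hsol t ht x).1
  have hvol : ∀ t ∈ J, ∀ x, HunterSaxton.imageVolume g (η t) x
      = (Real.cos (κ * t) + b x * Real.sin (κ * t)) ^ 2 * HunterSaxton.imageVolume g id x := by
    intro t ht x
    have h := HunterSaxton.volume_of_riccati hJ hJ_nontrivial hJ_zero
      (r := fun s => HunterSaxton.divergence g (u s) (η s x))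
      (m := fun s => HunterSaxton.imageVolume g (η s) x)
      (fun s hs => (hsol s hs x).1) (fun s hs => (hsol s hs x).2)
      (fun s hs => hflow.hasDerivWithinAt_imageVolume g hs (hsm s hs) x) ht
    rwa [hη0] at h
  have hjac : ∀ t ∈ J, ∀ x, HunterSaxton.jacobian g (η t) x
      = (Real.cos (κ * t) + b x * Real.sin (κ * t)) ^ 2 := by
    intro t ht x
    rw [HunterSaxton.jacobian_eq_div, hvol t ht x,
      mul_div_cancel_right₀ _ (HunterSaxton.imageVolume_id_pos g x).ne']
  refine ⟨fun t ht x => ?_, hjac, fun Ω hΩ t ht x => ?_, fun hκ0 => ?_⟩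
  · rw [hρ' t ht]
    exact hsol t ht x
  · exact hflow.pullback_volumeForm hJ_zero hη0 hsm hΩ
      (c := fun s => (Real.cos (κ * s) + b x * Real.sin (κ * s)) ^ 2)
      (by fun_prop) (fun s hs => pow_pos (hpos s hs x) 2) (by simp) (fun s hs => hvol s hs x) ht
  · have hdc : Continuous (HunterSaxton.divergence g (u 0)) :=
      (HunterSaxton.contMDiff_divergence g (hsm 0 hJ_zero)).continuous
    have hbc : Continuous b := hdc.div_const _
    have hmem : ∀ f : M → ℝ, Continuous f → MemLp f 2 (HunterSaxton.volumeMeasure g) := by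
      intro f hf
      have := ChartedSpace.secondCountable_of_sigmaCompact (EuclideanSpace ℝ (Fin n)) M
      exact (memLp_two_iff_integrable_sq hf.aestronglyMeasurable).2
        (HunterSaxton.integrable_of_continuous g (hf.pow 2))
    -- If the total volume were 0, as for empty M, the quotient in `hκ` would be 0 by convention and
    -- force κ = 0.
    have hV0 : (HunterSaxton.volumeMeasure g).real univ ≠ 0 := by
      intro h
      rw [h] at hκ
      simp at hκ
      exact hκ0 hκ
    have hinner : ∀ (f k : M → ℝ) (hf : Continuous f) (hk : Continuous k),
        inner ℝ ((hmem f hf).toLp f) ((hmem k hk).toLp k)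
          = ∫ x, f x * k x ∂HunterSaxton.volumeMeasure g := by
      intro f k hf hk
      rw [L2.inner_def]
      refine integral_congr_ae ?_
      filter_upwards [(hmem f hf).coeFn_toLp, (hmem k hk).coeFn_toLp] with x h1 h2
      rw [h1, h2]
      simp [mul_comm]
    have hbsq : ∫ x, b x * b x ∂HunterSaxton.volumeMeasure g
        = (HunterSaxton.volumeMeasure g).real univ := by
      have h1 : ∀ x, b x * b x = (1 / (4 * κ ^ 2)) * HunterSaxton.divergence g (u 0) x ^ 2 := by
        intro x
        simp only [hb]
        field_simp
        ring
      rw [integral_congr_ae (Filter.Eventually.of_forall h1), integral_const_mul]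
      field_simp at hκ ⊢
      linarith
    -- Orthogonality of 1 and div u₀ / 2κ is the divergence theorem.
    have hb0 : ∫ x, 1 * b x ∂HunterSaxton.volumeMeasure g = 0 := by
      simp only [hb, one_mul]
      rw [integral_div, HunterSaxton.integral_divergence_eq_zero g (hsm 0 hJ_zero), zero_div]
    refine ⟨(hmem _ continuous_const).toLp fun _ => (1 : ℝ), (hmem b hbc).toLp b,
      (hmem _ continuous_const).coeFn_toLp, (hmem b hbc).coeFn_toLp, ?_, ?_, ?_, ?_⟩
    · rw [norm_eq_sqrt_real_inner, hinner _ _ continuous_const continuous_const]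
      simp
    · rw [norm_eq_sqrt_real_inner, hinner _ _ hbc hbc, hbsq]
    · rw [hinner _ _ continuous_const hbc, hb0]
    · intro t ht
      set p := (hmem _ continuous_const).toLp fun _ => (1 : ℝ) with hp
      set w := (hmem b hbc).toLp b with hw
      filter_upwards [(hmem _ continuous_const).coeFn_toLp (f := fun _ => (1 : ℝ)),
        (hmem b hbc).coeFn_toLp, Lp.coeFn_add (Real.cos (κ * t) • p) (Real.sin (κ * t) • w),
        Lp.coeFn_smul (Real.cos (κ * t)) p, Lp.coeFn_smul (Real.sin (κ * t)) w]
        with x h1 h2 h3 h4 h5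
      rw [h3, Pi.add_apply, h4, h5, Pi.smul_apply, Pi.smul_apply, h1, h2, hjac t ht x,
        Real.sqrt_sq (hpos t ht x).le]
      simp [mul_comm]
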